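/- **Setting.** Let $n\ge 2$ and let $\lambda$ be a probability distribution on outcome profiles $o\in\{0,1\}^n$ that is invariant under permutations of the coordinates; let $\lambda_k=\Pr[\|o\|_1=k]$, $0\le k\le n$. A collection of marginals is a family $f=(f_{k,1},f_{k,0})_{0\le k\le n}$ of probability distributions on $[0,1]$. It is *feasible* if it is calibrated: $$x=\frac{\sum_{k=1}^n\lambda_k k f_{k,1}(x)}{\sum_{k=1}^n\lambda_k k f_{k,1}(x)+\sum_{k=0}^{n-1}\lambda_k(n-k)f_{k,0}(x)},\qquad x\in[0,1],$$ understood as an identity between measures (the identity function is the density of the numerator with respect to the denominator). Let $$t_k=t_k(f)=\sup\Big\{t\in[0,1]:\int_t^1\tfrac12\big(kf_{k,1}(x)+(n-k)f_{k,0}(x)\big)\,dx\ge 1\Big\},$$ where integrals over $[t,1]$ include the endpoint $t$. Let $\mathcal F^\dagger$ be the set of feasible $f$ such that, as measures, $f_{1,1}\le(n-1)f_{1,0}$ on $(t_1,1]$ and $f_{n-1,0}\le(n-1)f_{n-1,1}$ on $(t_{n-1},1]$. Consider the program $$(\mathcal P^\dagger)\qquad\max_{f\in\mathcal F^\dagger}\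 \sum_{k=0}^n\lambda_k\Big(\int_{t_k}^1(x-t_k)\big(\tfrac k2f_{k,1}(x)+\tfrac{n-k}2f_{k,0}(x)\big)\,dx+t_k\Big).$$ Put $A=\sum_{k=2}^n(k-2)\lambda_k$ and $$x^\star=\frac{\lambda_1A+2\lambda_1\lambda_0(1-\sqrt2)}{\lambda_1+\sqrt2\lambda_0}\vee 0,\qquad y^\star=A-x^\star .$$ Let (LinSys) be the following system for $(b^h_k,b^l_k)_{2\le k\le n}$: $b^h_k,b^l_k\ge0$ and $b^h_k+b^l_k=\frac{k-2}k$ for all $k$; $\sum_{k=2}^n\lambda_kkb^h_k=x^\star$; $\sum_{k=2}^n\lambda_kk(b^h_k+b^l_k)=A$; and $b^l_n>0$. Let (LinSys$_0$) be the same system without the requirement $b^l_n>0$. For a solution of either, put $$t_1^\star=\frac{\lambda_1+\sum_{k=2}^n\lambda_kkb^h_k}{2\lambda_1+\sum_{k=2}^n\lambda_kkb^h_k},\qquad t_0^\star=\frac{\sum_{k=2}^n\lambda_kkb^l_k}{2\lambda_0+\sum_{k=2}^n\lambda_kkb^l_k}.$$ (In the degenerate cases in which one of these fractions is $0/0$,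 it is read as $0$.) **Proposition.** 1. The two-variable program $$\max_{x,y\ge0,\ x+y=A}\ \frac{\lambda_1+x}{2\lambda_1+x}\lambda_1+\frac{y}{2\lambda_0+y}\lambda_0+\sum_{k=2}^n\lambda_k$$ is concave, and $(x^\star,y^\star)$ is an optimal solution of it. 2. (LinSys$_0$) has a solution; if $n\ge3$ and $\lambda_0>0$, then (LinSys) has a solution. 3. For every solution of (LinSys$_0$), hence for every solution of (LinSys), the marginals $$f^\star_{1,1}=\delta_{t_1^\star},\qquad f^\star_{k,1}=\tfrac2k\delta_1+b^h_k\delta_{t_1^\star}+b^l_k\delta_{t_0^\star}\quad(k\ge2),$$ $$f^\star_{0,0}=\frac{2\delta_{t_0^\star}+(n-2)\delta_0}{n},\qquad f^\star_{1,0}=\frac{\delta_{t_1^\star}+(n-2)\delta_0}{n-1},\qquad f^\star_{k,0}=\delta_0\quad(k\ge2)$$ (with $f^\star_{0,1}=\delta_0$, whose choice is immaterial) belong to $\mathcal F^\dagger$ and are an optimal solution of $(\mathcal P^\dagger)$. The optimal value equals the optimal value of the program in 1. In particular these optimal marginals only use the four signals $0,t_0^\star,t_1^\star,1$. -/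

import Mathlib

open MeasureTheory

noncomputable section

namespace CalibratedAuction

/-- A symmetric (exchangeable), possibly correlated, prior distribution of the click outcome
profile `o ∈ {0,1}^n` of `n` bidders. -/
structure OutcomePrior (n : ℕ) where
  prob : (Fin n → Bool) → ℝ
  nonneg : ∀ o, 0 ≤ prob o
  sum_eq_one : ∑ o, prob o = 1
  symm : ∀ (σ : Equiv.Perm (Fin n)) (o : Fin n → Bool), prob (fun i => o (σ i)) = prob o

/-- `lev L k` is the probability `λ_k` that exactly `k` of the outcomes are `1`. -/
def lev {n : ℕ} (L : OutcomePrior n) (k : ℕ) : ℝ :=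
  ∑ o : Fin n → Bool with (Finset.univ.filter (fun i => o i = true)).card = k, L.prob o

/-- A collection of bid marginals: `one k` is the bid distribution `f_{k,1}` of a bidder with
outcome `1`, and `zero k` the distribution `f_{k,0}` of a bidder with outcome `0`, when exactly
`k` outcomes are `1`. Only the indices `0 ≤ k ≤ n` matter. -/
@[ext] structure Marginals where
  one : ℕ → Measure ℝ
  zero : ℕ → Measure ℝ

/-- Probability distributions on `[0,1]`. -/
def IsDist (m : Measure ℝ) : Prop :=
  IsProbabilityMeasure m ∧ m (Set.Icc 0 1)ᶜ = 0

/-- Minimum second-highest bid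
`t_k = sup {t ∈ [0,1] : ∫_t^1 (k f_{k,1} + (n-k) f_{k,0}) / 2 ≥ 1}`. -/
def minSecmax (n : ℕ) (f : Marginals) (k : ℕ) : ℝ :=
  sSup {t : ℝ | t ∈ Set.Icc (0 : ℝ) 1 ∧
    1 ≤ (1 / 2 : ℝ) * ((k : ℝ) * (f.one k).real (Set.Icc t 1)
      + ((n : ℝ) - k) * (f.zero k).real (Set.Icc t 1))}

/-- The calibration (Bayes consistency) condition
`x = ∑_{k=1}^n λ_k k f_{k,1}(x) / (∑_{k=1}^n λ_k k f_{k,1}(x) + ∑_{k=0}^{n-1} λ_k (n-k) f_{k,0}(x))`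
for distributions on `[0,1]`, i.e. `x` is the Radon-Nikodym derivative of the numerator measure
with respect to the denominator measure. -/
def Calibrated {n : ℕ} (L : OutcomePrior n) (f : Marginals) : Prop :=
  ∀ B : Set ℝ, MeasurableSet B →
    (∑ k ∈ Finset.Icc 1 n, lev L k * k * ∫ x in B, x ∂(f.one k))
      + (∑ k ∈ Finset.range n, lev L k * ((n : ℝ) - k) * ∫ x in B, x ∂(f.zero k))
    = ∑ k ∈ Finset.Icc 1 n, lev L k * k * (f.one k).real B

/-- The set of feasible marginals. -/
def feasible {n : ℕ} (L : OutcomePrior n) : Set Marginals :=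
  {f | (∀ k ≤ n, IsDist (f.one k) ∧ IsDist (f.zero k)) ∧ Calibrated L f}

/-- Feasible marginals with, in addition, `f_{1,1} ≤ (n-1) f_{1,0}` on `(t_1, 1]` and
`f_{n-1,0} ≤ (n-1) f_{n-1,1}` on `(t_{n-1}, 1]` (as measures). -/
def feasibleDagger {n : ℕ} (L : OutcomePrior n) : Set Marginals :=
  {f | f ∈ feasible L ∧
    (∀ B : Set ℝ, MeasurableSet B → B ⊆ Set.Ioc (minSecmax n f 1) 1 →
      (f.one 1).real B ≤ ((n : ℝ) - 1) * (f.zero 1).real B) ∧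
    (∀ B : Set ℝ, MeasurableSet B → B ⊆ Set.Ioc (minSecmax n f (n - 1)) 1 →
      (f.zero (n - 1)).real B ≤ ((n : ℝ) - 1) * (f.one (n - 1)).real B)}

/-- The seller's revenue
`∑_k λ_k (∫_{t_k}^1 (x - t_k) (k/2 f_{k,1}(x) + (n-k)/2 f_{k,0}(x)) dx + t_k)`. -/
def revenue {n : ℕ} (L : OutcomePrior n) (f : Marginals) : ℝ :=
  ∑ k ∈ Finset.range (n + 1), lev L k *
    (((k : ℝ) / 2 * ∫ x in Set.Icc (minSecmax n f k) 1, (x - minSecmax n f k) ∂(f.one k))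
      + (((n : ℝ) - k) / 2 *
          ∫ x in Set.Icc (minSecmax n f k) 1, (x - minSecmax n f k) ∂(f.zero k))
      + minSecmax n f k)

/-- `A = ∑_{k=2}^n (k-2) λ_k`. -/
def slack {n : ℕ} (L : OutcomePrior n) : ℝ :=
  ∑ k ∈ Finset.Icc 2 n, ((k : ℝ) - 2) * lev L k

/-- `x* = ((λ_1 A + 2 λ_1 λ_0 (1 - √2)) / (λ_1 + √2 λ_0)) ∨ 0`. -/
def xStar {n : ℕ} (L : OutcomePrior n) : ℝ :=
  max ((lev L 1 * slack L + 2 * lev L 1 * lev L 0 * (1 - Real.sqrt 2))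
    / (lev L 1 + Real.sqrt 2 * lev L 0)) 0

/-- `∑_{k=2}^n λ_k k b_k`. -/
def weight {n : ℕ} (L : OutcomePrior n) (b : ℕ → ℝ) : ℝ :=
  ∑ k ∈ Finset.Icc 2 n, lev L k * k * b k

/-- The linear system for `(b^h_k, b^l_k)_{2 ≤ k ≤ n}`, without its strict inequality. -/
structure LinSysWeak {n : ℕ} (L : OutcomePrior n) (bh bl : ℕ → ℝ) : Prop where
  nonneg : ∀ k ∈ Finset.Icc 2 n, 0 ≤ bh k ∧ 0 ≤ bl k
  add_eq : ∀ k ∈ Finset.Icc 2 n, bh k + bl k = ((k : ℝ) - 2) / k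
  weight_high : weight L bh = xStar L
  weight_total : weight L bh + weight L bl = slack L

/-- The linear system, with the strict inequality `b^l_n > 0`. -/
structure LinSys {n : ℕ} (L : OutcomePrior n) (bh bl : ℕ → ℝ) : Prop
    extends LinSysWeak L bh bl where
  pos : 0 < bl n

/-- `t*_1 = (λ_1 + ∑ λ_k k b^h_k) / (2 λ_1 + ∑ λ_k k b^h_k)`. -/
def tOne {n : ℕ} (L : OutcomePrior n) (bh : ℕ → ℝ) : ℝ :=
  (lev L 1 + weight L bh) / (2 * lev L 1 + weight L bh)

/-- `t*_0 = (∑ λ_k k b^l_k) / (2 λ_0 + ∑ λ_k k b^l_k)`. -/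
def tZero {n : ℕ} (L : OutcomePrior n) (bl : ℕ → ℝ) : ℝ :=
  weight L bl / (2 * lev L 0 + weight L bl)

/-- The explicit marginals. The value of `f_{0,1}` (no bidder has outcome `1` if `k = 0`) is
immaterial and set to the point mass at `0`. -/
def optMarginals {n : ℕ} (L : OutcomePrior n) (bh bl : ℕ → ℝ) : Marginals where
  one k :=
    if k = 0 then Measure.dirac 0
    else if k = 1 then Measure.dirac (tOne L bh)
    else ENNReal.ofReal (2 / (k : ℝ)) • Measure.dirac 1
      + ENNReal.ofReal (bh k) • Measure.dirac (tOne L bh)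
      + ENNReal.ofReal (bl k) • Measure.dirac (tZero L bl)
  zero k :=
    if k = 0 then ENNReal.ofReal (2 / (n : ℝ)) • Measure.dirac (tZero L bl)
      + ENNReal.ofReal (((n : ℝ) - 2) / n) • Measure.dirac 0
    else if k = 1 then ENNReal.ofReal (1 / ((n : ℝ) - 1)) • Measure.dirac (tOne L bh)
      + ENNReal.ofReal (((n : ℝ) - 2) / ((n : ℝ) - 1)) • Measure.dirac 0
    else Measure.dirac 0

/-- The domain `{(x, y) : x, y ≥ 0, x + y = A}` of the two-variable program. -/
def programDomain {n : ℕ} (L : OutcomePrior n) : Set (ℝ × ℝ) :=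
  {p | 0 ≤ p.1 ∧ 0 ≤ p.2 ∧ p.1 + p.2 = slack L}

/-- The objective of the two-variable program,
`λ_1 (λ_1 + x) / (2 λ_1 + x) + λ_0 y / (2 λ_0 + y) + ∑_{k=2}^n λ_k`. -/
def programValue {n : ℕ} (L : OutcomePrior n) (p : ℝ × ℝ) : ℝ :=
  (lev L 1 + p.1) / (2 * lev L 1 + p.1) * lev L 1
    + p.2 / (2 * lev L 0 + p.2) * lev L 0
    + ∑ k ∈ Finset.Icc 2 n, lev L k

end CalibratedAuction

end

open MeasureTheory

noncomputable section

namespace CalibratedAuction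

/-! ### Integration against distributions on the unit interval -/

/-! The upper bound is linear programming duality. Calibration says that, for every bounded
measurable `g`, the terms `λ_k k ∫ g(x)(1-x) df_{k,1}` minus `λ_k (n-k) ∫ g(x) x df_{k,0}` sum to
zero (`Calibrated.integral_eq`). Adding this zero with `g = multiplier p` splits the revenue into
contributions of single levels `k` (`revenue_eq_sum_lagrangianAt`), and each level is bounded
separately.

Since `t_k` is a quantile, the revenue of level `k` is at most `s + ∫ (x-s)⁺` against `(k f_{k,1} +
(n-k) f_{k,0})/2`, for every threshold `s` (`revenueAt_le`). With `p = q²/2`, a suitable `s` and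
pointwise inequalities give `1 + (k-2)p` for `k ≥ 2` and `(1-q)²` for `k = 0`. Level one needs
`f_{1,1} ≤ (n-1) f_{1,0}` above `t_1`: the part of the integrand in which the two outcomes differ
then contributes nothing positive (`lagrangianAt_one_le_of_low`). The sum is `dualValue L q v`
(`revenue_le_dualValue`).

The same function is dual to the two-variable program, where `p` is the price of the resource `A = x
+ y`. Equating the marginal values of `x` and `y`, or taking the corner `x = 0`, yields `q` and `v`
with no duality gap at `x*` (`exists_dualValue_le`).

The explicit marginals are calibrated atom by atom. On each level no bid mass lies strictly above
`t_k`, so their revenue is `∑ λ_k t_k`, which is the program value at `x*`. Both optimality claims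
follow from the one dual certificate. -/

lemma IsDist.ae_mem {m : Measure ℝ} (h : IsDist m) : ∀ᵐ x ∂m, x ∈ Set.Icc (0 : ℝ) 1 :=
  mem_ae_iff.2 h.2

lemma integrable_of_abs_le_on_Icc {m : Measure ℝ} [IsFiniteMeasure m]
    (h : ∀ᵐ x ∂m, x ∈ Set.Icc (0 : ℝ) 1) {g : ℝ → ℝ} (hg : Measurable g) (C : ℝ)
    (hC : ∀ x ∈ Set.Icc (0 : ℝ) 1, |g x| ≤ C) : Integrable g m :=
  Integrable.of_bound hg.aestronglyMeasurable C (h.mono fun x hx => hC x hx)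

lemma integral_mono_on_Icc {m : Measure ℝ} [IsFiniteMeasure m]
    (h : ∀ᵐ x ∂m, x ∈ Set.Icc (0 : ℝ) 1) {g g' : ℝ → ℝ} (hg : Integrable g m)
    (hg' : Integrable g' m) (hle : ∀ x ∈ Set.Icc (0 : ℝ) 1, g x ≤ g' x) :
    ∫ x, g x ∂m ≤ ∫ x, g' x ∂m :=
  integral_mono_ae hg hg' (h.mono fun x hx => hle x hx)

lemma IsDist.integral_le {m : Measure ℝ} (h : IsDist m) {g : ℝ → ℝ} (hg : Integrable g m)
    {c : ℝ} (hle : ∀ x ∈ Set.Icc (0 : ℝ) 1, g x ≤ c) : ∫ x, g x ∂m ≤ c := by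
  have := h.1
  calc ∫ x, g x ∂m ≤ ∫ _, c ∂m :=
        integral_mono_on_Icc h.ae_mem hg (integrable_const c) hle
    _ = c := by simp

/-! ### Quantiles -/

/-- Continuity from above along `[u_i, 1]` with `u_i ↑ T` shows that the supremum is attained;
continuity from below along `u_i ↓ T` bounds the mass strictly above `T`. An atom at `T` makes the
two bounds differ. -/
lemma quantile_spec (μ : Measure ℝ) [IsFiniteMeasure μ] (h : 1 ≤ μ.real (Set.Icc 0 1)) :
    let T := sSup {t : ℝ | t ∈ Set.Icc (0 : ℝ) 1 ∧ 1 ≤ μ.real (Set.Icc t 1)}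
    T ∈ Set.Icc (0 : ℝ) 1 ∧ 1 ≤ μ.real (Set.Icc T 1) ∧ μ.real (Set.Ioc T 1) ≤ 1 := by
  intro T
  set S := {t : ℝ | t ∈ Set.Icc (0 : ℝ) 1 ∧ 1 ≤ μ.real (Set.Icc t 1)} with hS
  have h0 : (0 : ℝ) ∈ S := ⟨by simp, h⟩
  have hb : BddAbove S := ⟨1, fun t ht => ht.1.2⟩
  have hT0 : 0 ≤ T := le_csSup hb h0
  have hT1 : T ≤ 1 := csSup_le ⟨0, h0⟩ fun t ht => ht.1.2
  refine ⟨⟨hT0, hT1⟩, ?_, ?_⟩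
  · obtain ⟨u, hum, hut, huS⟩ := exists_seq_tendsto_sSup ⟨0, h0⟩ hb
    have hI : Set.Icc T 1 = ⋂ i, Set.Icc (u i) 1 := by
      ext x
      simp only [Set.mem_Icc, Set.mem_iInter]
      constructor
      · exact fun hx i => ⟨(le_csSup hb (huS i)).trans hx.1, hx.2⟩
      · exact fun hx => ⟨le_of_tendsto' hut fun i => (hx i).1, (hx 0).2⟩
    have hlim : Filter.Tendsto (fun i => μ (Set.Icc (u i) 1)) Filter.atTop
        (nhds (μ (⋂ i, Set.Icc (u i) 1))) :=
      tendsto_measure_iInter_atTop (fun i => measurableSet_Icc.nullMeasurableSet)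
        (fun i j hij => Set.Icc_subset_Icc_left (hum hij)) ⟨0, measure_ne_top _ _⟩
    rw [hI]
    exact ge_of_tendsto' ((ENNReal.tendsto_toReal (measure_ne_top _ _)).comp hlim)
      fun i => (huS i).2
  · obtain ⟨u, hum, huT, hut⟩ := exists_seq_strictAnti_tendsto T
    have hI : Set.Ioc T 1 = ⋃ i, Set.Icc (u i) 1 := by
      ext x
      simp only [Set.mem_Ioc, Set.mem_Icc, Set.mem_iUnion]
      constructor
      · rintro ⟨hx, hx1⟩
        obtain ⟨i, hi⟩ := (hut.eventually (gt_mem_nhds hx)).exists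
        exact ⟨i, hi.le, hx1⟩
      · rintro ⟨i, hi, hx1⟩
        exact ⟨(huT i).trans_le hi, hx1⟩
    have hlim : Filter.Tendsto (fun i => μ (Set.Icc (u i) 1)) Filter.atTop
        (nhds (μ (⋃ i, Set.Icc (u i) 1))) :=
      tendsto_measure_iUnion_atTop
        fun i j hij => Set.Icc_subset_Icc_left (hum.antitone hij)
    rw [hI]
    refine le_of_tendsto' ((ENNReal.tendsto_toReal (measure_ne_top _ _)).comp hlim) fun i => ?_
    by_contra hcon
    have hcon' : 1 < μ.real (Set.Icc (u i) 1) := not_le.1 hcon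
    have hu1 : u i ≤ 1 := by
      by_contra h1
      rw [Set.Icc_eq_empty h1] at hcon'
      simp at hcon'
      linarith
    exact absurd (le_csSup hb (show u i ∈ S from ⟨⟨hT0.trans (huT i).le, hu1⟩, hcon'.le⟩))
      (not_le.2 (huT i))

/-- The measure of bids relevant for the second highest bid, `(k f_{k,1} + (n-k) f_{k,0}) / 2`. -/
def bidMeasure (n : ℕ) (f : Marginals) (k : ℕ) : Measure ℝ :=
  ENNReal.ofReal ((k : ℝ) / 2) • f.one k + ENNReal.ofReal (((n : ℝ) - k) / 2) • f.zero k

lemma minSecmax_spec {n k : ℕ} (hn : 2 ≤ n) (hk : k ≤ n) {f : Marginals}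
    (h1 : IsDist (f.one k)) (h0 : IsDist (f.zero k)) :
    minSecmax n f k ∈ Set.Icc (0 : ℝ) 1 ∧
    2 ≤ (k : ℝ) * (f.one k).real (Set.Icc (minSecmax n f k) 1)
      + ((n : ℝ) - k) * (f.zero k).real (Set.Icc (minSecmax n f k) 1) ∧
    (k : ℝ) * (f.one k).real (Set.Ioc (minSecmax n f k) 1)
      + ((n : ℝ) - k) * (f.zero k).real (Set.Ioc (minSecmax n f k) 1) ≤ 2 := by
  have := h1.1
  have := h0.1
  have hkn : (0 : ℝ) ≤ (n : ℝ) - k := sub_nonneg.2 (by exact_mod_cast hk)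
  have hk0 : (0 : ℝ) ≤ k := k.cast_nonneg
  have hn' : (2 : ℝ) ≤ n := by exact_mod_cast hn
  have : IsFiniteMeasure (bidMeasure n f k) := by
    unfold bidMeasure
    have : IsFiniteMeasure (ENNReal.ofReal ((k : ℝ) / 2) • f.one k) :=
      Measure.smul_finite _ ENNReal.ofReal_ne_top
    have : IsFiniteMeasure (ENNReal.ofReal (((n : ℝ) - k) / 2) • f.zero k) :=
      Measure.smul_finite _ ENNReal.ofReal_ne_top
    infer_instance
  have hreal : ∀ B, (bidMeasure n f k).real B
      = (1 / 2 : ℝ) * ((k : ℝ) * (f.one k).real B + ((n : ℝ) - k) * (f.zero k).real B) := by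
    intro B
    have : IsFiniteMeasure (ENNReal.ofReal ((k : ℝ) / 2) • f.one k) :=
      Measure.smul_finite _ ENNReal.ofReal_ne_top
    have : IsFiniteMeasure (ENNReal.ofReal (((n : ℝ) - k) / 2) • f.zero k) :=
      Measure.smul_finite _ ENNReal.ofReal_ne_top
    unfold bidMeasure
    rw [measureReal_add_apply, measureReal_ennreal_smul_apply, measureReal_ennreal_smul_apply,
      ENNReal.toReal_ofReal (by positivity), ENNReal.toReal_ofReal (by positivity)]
    ring
  have hone : ∀ {m : Measure ℝ}, IsDist m → m.real (Set.Icc 0 1) = 1 := by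
    intro m hm
    have := hm.1
    rw [measureReal_def, prob_compl_eq_zero_iff measurableSet_Icc |>.1 hm.2]
    simp
  have hmass : 1 ≤ (bidMeasure n f k).real (Set.Icc 0 1) := by
    rw [hreal, hone h1, hone h0]
    linarith
  have key := quantile_spec (bidMeasure n f k) hmass
  simp only [hreal] at key
  obtain ⟨a, b, c⟩ := key
  exact ⟨a, by unfold minSecmax; linarith, by unfold minSecmax; linarith⟩

/-! ### Calibration against test functions -/

lemma withDensity_real_apply {m : Measure ℝ} (h : IsDist m) {B : Set ℝ} (hB : MeasurableSet B) :
    ((m.withDensity ENNReal.ofReal) B).toReal = ∫ x in B, x ∂m := by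
  have := h.1
  rw [withDensity_apply _ hB]
  exact (integral_eq_lintegral_of_nonneg_ae
    (ae_restrict_of_ae (h.ae_mem.mono fun x hx => hx.1)) aestronglyMeasurable_id).symm

lemma integral_withDensity {m : Measure ℝ} (h : IsDist m) (g : ℝ → ℝ) :
    ∫ x, g x ∂(m.withDensity ENNReal.ofReal) = ∫ x, g x * x ∂m := by
  rw [integral_withDensity_eq_integral_toReal_smul ENNReal.measurable_ofReal
    (Filter.Eventually.of_forall fun x => ENNReal.ofReal_lt_top)]
  refine integral_congr_ae (h.ae_mem.mono fun x hx => ?_)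
  simp [ENNReal.toReal_ofReal hx.1, mul_comm]

lemma isFiniteMeasure_withDensity_id {m : Measure ℝ} (h : IsDist m) :
    IsFiniteMeasure (m.withDensity ENNReal.ofReal) := by
  have := h.1
  refine isFiniteMeasure_withDensity ?_
  refine ne_of_lt (lt_of_le_of_lt (lintegral_mono_ae (h.ae_mem.mono fun x hx =>
    (ENNReal.ofReal_le_one.2 hx.2))) ?_)
  simp

lemma lev_nonneg {n : ℕ} (L : OutcomePrior n) (k : ℕ) : 0 ≤ lev L k :=
  Finset.sum_nonneg fun o _ => L.nonneg o

/-- Calibration on sets is an equality of finite measures, the left one having density `x`.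
Integrating `g` against both sides passes from sets to test functions. -/
lemma Calibrated.integral_eq {n : ℕ} {L : OutcomePrior n} {f : Marginals}
    (hf : f ∈ feasible L) {g : ℝ → ℝ} (hg : Measurable g) {C : ℝ} (hC : ∀ x, |g x| ≤ C) :
    (∑ k ∈ Finset.Icc 1 n, lev L k * k * ∫ x, g x * x ∂(f.one k))
      + (∑ k ∈ Finset.range n, lev L k * ((n : ℝ) - k) * ∫ x, g x * x ∂(f.zero k))
    = ∑ k ∈ Finset.Icc 1 n, lev L k * k * ∫ x, g x ∂(f.one k) := by
  have hI : ∀ k ∈ Finset.Icc 1 n, IsDist (f.one k) := fun k hk =>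
    (hf.1 k (Finset.mem_Icc.1 hk).2).1
  have hR : ∀ k ∈ Finset.range n, IsDist (f.zero k) := fun k hk =>
    (hf.1 k (Finset.mem_range.1 hk).le).2
  have hc1 : ∀ k : ℕ, 0 ≤ lev L k * k := fun k => mul_nonneg (lev_nonneg L k) k.cast_nonneg
  have hc0 : ∀ k ∈ Finset.range n, 0 ≤ lev L k * ((n : ℝ) - k) := fun k hk =>
    mul_nonneg (lev_nonneg L k)
      (sub_nonneg.2 (by exact_mod_cast (Finset.mem_range.1 hk).le))
  have hint : ∀ m : Measure ℝ, IsFiniteMeasure m → ∀ c : ℝ,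
      Integrable g (ENNReal.ofReal c • m) := fun m _ c =>
    (Integrable.of_bound hg.aestronglyMeasurable C
      (Filter.Eventually.of_forall hC)).smul_measure ENNReal.ofReal_ne_top
  set D1 : Measure ℝ := ∑ k ∈ Finset.Icc 1 n,
    ENNReal.ofReal (lev L k * k) • (f.one k).withDensity ENNReal.ofReal with hD1
  set D0 : Measure ℝ := ∑ k ∈ Finset.range n,
    ENNReal.ofReal (lev L k * ((n : ℝ) - k)) • (f.zero k).withDensity ENNReal.ofReal with hD0
  set N1 : Measure ℝ := ∑ k ∈ Finset.Icc 1 n, ENNReal.ofReal (lev L k * k) • f.one k with hN1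
  have hD1fin : ∀ k ∈ Finset.Icc 1 n, ∀ B : Set ℝ, ENNReal.ofReal (lev L k * k)
      * (f.one k).withDensity ENNReal.ofReal B ≠ ⊤ := fun k hk B => by
    have := isFiniteMeasure_withDensity_id (hI k hk)
    exact ENNReal.mul_ne_top ENNReal.ofReal_ne_top (measure_ne_top _ _)
  have hD0fin : ∀ k ∈ Finset.range n, ∀ B : Set ℝ, ENNReal.ofReal (lev L k * ((n : ℝ) - k))
      * (f.zero k).withDensity ENNReal.ofReal B ≠ ⊤ := fun k hk B => by
    have := isFiniteMeasure_withDensity_id (hR k hk)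
    exact ENNReal.mul_ne_top ENNReal.ofReal_ne_top (measure_ne_top _ _)
  have hN1fin : ∀ k ∈ Finset.Icc 1 n, ∀ B : Set ℝ, ENNReal.ofReal (lev L k * k)
      * f.one k B ≠ ⊤ := fun k hk B => by
    have := (hI k hk).1
    exact ENNReal.mul_ne_top ENNReal.ofReal_ne_top (measure_ne_top _ _)
  have hmeas : D1 + D0 = N1 := by
    ext B hB
    have hcal := hf.2 B hB
    simp only [hD1, hD0, hN1, Measure.add_apply, Measure.finsetSum_apply, Measure.smul_apply,
      smul_eq_mul]
    have e1 := ENNReal.sum_ne_top.2 fun k hk => hD1fin k hk B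
    have e2 := ENNReal.sum_ne_top.2 fun k hk => hD0fin k hk B
    have e3 := ENNReal.sum_ne_top.2 fun k hk => hN1fin k hk B
    rw [← ENNReal.toReal_eq_toReal_iff' (ENNReal.add_ne_top.2 ⟨e1, e2⟩) e3,
      ENNReal.toReal_add e1 e2, ENNReal.toReal_sum fun k hk => hD1fin k hk B,
      ENNReal.toReal_sum fun k hk => hD0fin k hk B,
      ENNReal.toReal_sum fun k hk => hN1fin k hk B]
    convert hcal using 2
    · refine Finset.sum_congr rfl fun k hk => ?_
      rw [ENNReal.toReal_mul, ENNReal.toReal_ofReal (hc1 k), withDensity_real_apply (hI k hk) hB]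
    · refine Finset.sum_congr rfl fun k hk => ?_
      rw [ENNReal.toReal_mul, ENNReal.toReal_ofReal (hc0 k hk),
        withDensity_real_apply (hR k hk) hB]
    · rw [ENNReal.toReal_mul, ENNReal.toReal_ofReal (hc1 _), measureReal_def]
  have hintD1 : ∀ k ∈ Finset.Icc 1 n, Integrable g
      (ENNReal.ofReal (lev L k * k) • (f.one k).withDensity ENNReal.ofReal) := fun k hk =>
    hint _ (isFiniteMeasure_withDensity_id (hI k hk)) _
  have hintD0 : ∀ k ∈ Finset.range n, Integrable g
      (ENNReal.ofReal (lev L k * ((n : ℝ) - k)) • (f.zero k).withDensity ENNReal.ofReal) :=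
    fun k hk => hint _ (isFiniteMeasure_withDensity_id (hR k hk)) _
  have hintN1 : ∀ k ∈ Finset.Icc 1 n, Integrable g
      (ENNReal.ofReal (lev L k * k) • f.one k) := fun k hk =>
    have := (hI k hk).1
    hint _ inferInstance _
  have hfin := congrArg (fun m => ∫ x, g x ∂m) hmeas
  rw [integral_add_measure (integrable_finsetSum_measure.2 hintD1)
    (integrable_finsetSum_measure.2 hintD0), integral_finsetSum_measure hintD1,
    integral_finsetSum_measure hintD0, integral_finsetSum_measure hintN1] at hfin
  convert hfin using 2
  · refine Finset.sum_congr rfl fun k hk => ?_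
    rw [integral_smul_measure, integral_withDensity (hI k hk), ENNReal.toReal_ofReal (hc1 k),
      smul_eq_mul]
  · refine Finset.sum_congr rfl fun k hk => ?_
    rw [integral_smul_measure, integral_withDensity (hR k hk),
      ENNReal.toReal_ofReal (hc0 k hk), smul_eq_mul]
  · rw [integral_smul_measure, ENNReal.toReal_ofReal (hc1 _), smul_eq_mul]

/-! ### Weak duality -/

/-- The multiplier of the calibration constraint, `min (p / (1 - x)) (1 / 2)`. -/
def multiplier (p x : ℝ) : ℝ := if 1 - x ≤ 2 * p then 1 / 2 else p / (1 - x)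

lemma measurable_multiplier (p : ℝ) : Measurable (multiplier p) := by
  unfold multiplier
  refine Measurable.ite (measurableSet_le (by fun_prop) (by fun_prop)) (by fun_prop) ?_
  exact Measurable.div (by fun_prop) (by fun_prop)

lemma multiplier_of_le {p x : ℝ} (h : 1 - x ≤ 2 * p) : multiplier p x = 1 / 2 := if_pos h

lemma multiplier_mul_of_lt {p x : ℝ} (hp : 0 ≤ p) (h : 2 * p < 1 - x) :
    multiplier p x * (1 - x) = p := by
  rw [multiplier, if_neg (not_le.2 h), div_mul_cancel₀ _ (by linarith)]

lemma multiplier_nonneg {p : ℝ} (hp : 0 ≤ p) (x : ℝ) : 0 ≤ multiplier p x := by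
  unfold multiplier
  split_ifs with h
  · norm_num
  · exact div_nonneg hp (by linarith)

lemma multiplier_le_half {p : ℝ} (hp : 0 ≤ p) (x : ℝ) : multiplier p x ≤ 1 / 2 := by
  unfold multiplier
  split_ifs with h
  · exact le_rfl
  · rw [div_le_iff₀ (by linarith)]
    linarith

lemma abs_multiplier_le {p : ℝ} (hp : 0 ≤ p) (x : ℝ) : |multiplier p x| ≤ 1 / 2 := by
  rw [abs_of_nonneg (multiplier_nonneg hp x)]
  exact multiplier_le_half hp x

lemma multiplier_mul_one_sub_le {p x : ℝ} (hp : 0 ≤ p) : multiplier p x * (1 - x) ≤ p := by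
  rcases le_or_gt (1 - x) (2 * p) with h | h
  · rw [multiplier_of_le h]
    linarith
  · exact (multiplier_mul_of_lt hp h).le

/-- The part of the revenue that is due to the profiles with `k` outcomes equal to `1`. -/
def revenueAt (n : ℕ) (f : Marginals) (k : ℕ) : ℝ :=
  ((k : ℝ) / 2 * ∫ x in Set.Icc (minSecmax n f k) 1, (x - minSecmax n f k) ∂(f.one k))
    + (((n : ℝ) - k) / 2 *
        ∫ x in Set.Icc (minSecmax n f k) 1, (x - minSecmax n f k) ∂(f.zero k))
    + minSecmax n f k

/-- The contribution of level `k` to the Lagrangian. -/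
def lagrangianAt (p : ℝ) (n : ℕ) (f : Marginals) (k : ℕ) : ℝ :=
  revenueAt n f k + k * ∫ x, multiplier p x * (1 - x) ∂(f.one k)
    - ((n : ℝ) - k) * ∫ x, multiplier p x * x ∂(f.zero k)

lemma integrable_multiplier_mul {p : ℝ} (hp : 0 ≤ p) {m : Measure ℝ} (h : IsDist m) :
    Integrable (fun x => multiplier p x * x) m := by
  have := h.1
  refine integrable_of_abs_le_on_Icc h.ae_mem ((measurable_multiplier p).mul measurable_id) 1 ?_
  intro x hx
  rw [abs_mul, abs_of_nonneg hx.1]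
  have := abs_multiplier_le hp x
  nlinarith [hx.1, hx.2, abs_nonneg (multiplier p x)]

lemma integrable_multiplier {p : ℝ} (hp : 0 ≤ p) {m : Measure ℝ} (h : IsDist m) :
    Integrable (multiplier p) m := by
  have := h.1
  exact integrable_of_abs_le_on_Icc h.ae_mem (measurable_multiplier p) _
    fun x _ => abs_multiplier_le hp x

lemma integrable_multiplier_mul_one_sub {p : ℝ} (hp : 0 ≤ p) {m : Measure ℝ} (h : IsDist m) :
    Integrable (fun x => multiplier p x * (1 - x)) m := by
  simp only [mul_sub, mul_one]
  exact (integrable_multiplier hp h).sub (integrable_multiplier_mul hp h)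

/-- The penalty terms cancel over all levels by calibration tested on `multiplier p`; the levels
then decouple. -/
lemma revenue_eq_sum_lagrangianAt {n : ℕ} {L : OutcomePrior n} {f : Marginals}
    (hf : f ∈ feasible L) {p : ℝ} (hp : 0 ≤ p) :
    revenue L f = ∑ k ∈ Finset.range (n + 1), lev L k * lagrangianAt p n f k := by
  have hcal := Calibrated.integral_eq hf (measurable_multiplier p) (abs_multiplier_le hp)
  have h1 : ∑ k ∈ Finset.range (n + 1),
      lev L k * (k * ∫ x, multiplier p x * (1 - x) ∂(f.one k))
      = ∑ k ∈ Finset.Icc 1 n, lev L k * k * ∫ x, multiplier p x ∂(f.one k)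
        - ∑ k ∈ Finset.Icc 1 n, lev L k * k * ∫ x, multiplier p x * x ∂(f.one k) := by
    rw [← Finset.sum_sub_distrib]
    symm
    refine Finset.sum_subset_zero_on_sdiff (fun k hk => ?_) (fun k hk => ?_) (fun k hk => ?_)
    · simp only [Finset.mem_Icc] at hk
      simp only [Finset.mem_range]
      omega
    · simp only [Finset.mem_sdiff, Finset.mem_range, Finset.mem_Icc] at hk
      have : k = 0 := by omega
      simp [this]
    · have hd := (hf.1 k (Finset.mem_Icc.1 hk).2).1
      simp only [mul_sub, mul_one]
      rw [integral_sub (integrable_multiplier hp hd) (integrable_multiplier_mul hp hd)]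
      ring
  have h0 : ∑ k ∈ Finset.range (n + 1),
      lev L k * (((n : ℝ) - k) * ∫ x, multiplier p x * x ∂(f.zero k))
      = ∑ k ∈ Finset.range n, lev L k * ((n : ℝ) - k) * ∫ x, multiplier p x * x ∂(f.zero k) := by
    rw [Finset.sum_range_succ]
    simp [mul_assoc]
  have hsum : ∑ k ∈ Finset.range (n + 1), lev L k * lagrangianAt p n f k
      = revenue L f + ∑ k ∈ Finset.range (n + 1),
          lev L k * (k * ∫ x, multiplier p x * (1 - x) ∂(f.one k))
        - ∑ k ∈ Finset.range (n + 1),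
          lev L k * (((n : ℝ) - k) * ∫ x, multiplier p x * x ∂(f.zero k)) := by
    unfold revenue lagrangianAt revenueAt
    rw [← Finset.sum_add_distrib, ← Finset.sum_sub_distrib]
    exact Finset.sum_congr rfl fun k _ => by ring
  rw [hsum, h1, h0]
  linarith

/-! ### Revenue against an arbitrary threshold; bounds for `k ≥ 2` and `k = 0` -/

lemma integrable_sub {m : Measure ℝ} (h : IsDist m) (s : ℝ) :
    Integrable (fun x : ℝ => x - s) m := by
  have := h.1
  refine integrable_of_abs_le_on_Icc h.ae_mem (by fun_prop) (1 + |s|) fun x hx => ?_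
  calc |x - s| ≤ |x| + |s| := abs_sub _ _
    _ ≤ 1 + |s| := by rw [abs_of_nonneg hx.1]; linarith [hx.2]

lemma integrable_posPart_sub {m : Measure ℝ} (h : IsDist m) (s : ℝ) :
    Integrable (fun x : ℝ => max (x - s) 0) m :=
  (integrable_sub h s).pos_part

/-- Exchanging the quantile `t` for another threshold `s`. -/
lemma setIntegral_sub_le {m : Measure ℝ} (h : IsDist m) (t s : ℝ) :
    ∫ x in Set.Icc t 1, (x - t) ∂m ≤ (∫ x, max (x - s) 0 ∂m)
      + max (s - t) 0 * m.real (Set.Ioc t 1) - max (t - s) 0 * m.real (Set.Icc t 1) := by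
  have := h.1
  have e1 : max (s - t) 0 * m.real (Set.Ioc t 1)
      = ∫ x, (Set.Ioc t 1).indicator (fun _ => max (s - t) 0) x ∂m := by
    rw [integral_indicator measurableSet_Ioc]
    simp [mul_comm]
  have e2 : max (t - s) 0 * m.real (Set.Icc t 1)
      = ∫ x, (Set.Icc t 1).indicator (fun _ => max (t - s) 0) x ∂m := by
    rw [integral_indicator measurableSet_Icc]
    simp [mul_comm]
  have i0 := integrable_posPart_sub h s
  have i1 : Integrable ((Set.Ioc t 1).indicator (fun _ => max (s - t) 0)) m :=
    (integrable_const _).indicator measurableSet_Ioc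
  have i2 : Integrable ((Set.Icc t 1).indicator (fun _ => max (t - s) 0)) m :=
    (integrable_const _).indicator measurableSet_Icc
  have i01 : Integrable (fun x => max (x - s) 0
      + (Set.Ioc t 1).indicator (fun _ => max (s - t) 0) x) m := i0.add i1
  rw [e1, e2, ← integral_indicator measurableSet_Icc, ← integral_add i0 i1,
    ← integral_sub i01 i2]
  refine integral_mono_on_Icc h.ae_mem ((integrable_sub h t).indicator measurableSet_Icc)
    (i01.sub i2) fun x hx => ?_
  simp only [Set.indicator_apply, Set.mem_Icc, Set.mem_Ioc, hx.2, and_true]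
  rcases lt_trichotomy x t with hxt | hxt | hxt
  · rw [if_neg (not_le.2 hxt), if_neg (not_lt.2 hxt.le), if_neg (not_le.2 hxt)]
    simp
  · subst hxt
    simp
  · rw [if_pos hxt.le, if_pos hxt, if_pos hxt.le]
    rcases le_total s t with hst | hst
    · rw [max_eq_left (by linarith), max_eq_right (by linarith : s - t ≤ 0),
        max_eq_left (by linarith : 0 ≤ t - s)]
      linarith
    · rw [max_eq_left (by linarith : 0 ≤ s - t), max_eq_right (by linarith : t - s ≤ 0)]
      linarith [le_max_left (x - s) 0]

/-- A quantile minimises `s + ∫ (x-s)⁺` against the bid measure. Moving to `s > t` uses that this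
measure has mass at most one on `(t, 1]`, moving to `s < t` that it has mass at least one on `[t,
1]`. -/
lemma revenueAt_le {n k : ℕ} (hn : 2 ≤ n) (hk : k ≤ n) {f : Marginals}
    (h1 : IsDist (f.one k)) (h0 : IsDist (f.zero k)) (s : ℝ) :
    revenueAt n f k ≤ (k : ℝ) / 2 * ∫ x, max (x - s) 0 ∂(f.one k)
      + ((n : ℝ) - k) / 2 * ∫ x, max (x - s) 0 ∂(f.zero k) + s := by
  obtain ⟨-, hIcc, hIoc⟩ := minSecmax_spec hn hk h1 h0
  unfold revenueAt
  set t := minSecmax n f k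
  have hkn : (0 : ℝ) ≤ (n : ℝ) - k := sub_nonneg.2 (by exact_mod_cast hk)
  have a1 := mul_le_mul_of_nonneg_left (setIntegral_sub_le h1 t s)
    (by positivity : (0 : ℝ) ≤ k / 2)
  have a0 := mul_le_mul_of_nonneg_left (setIntegral_sub_le h0 t s)
    (by positivity : (0 : ℝ) ≤ ((n : ℝ) - k) / 2)
  have b1 := mul_le_mul_of_nonneg_left hIcc (le_max_right (t - s) 0)
  have b0 := mul_le_mul_of_nonneg_left hIoc (le_max_right (s - t) 0)
  have c : max (s - t) 0 - max (t - s) 0 = s - t := by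
    rcases le_total s t with hst | hst
    · rw [max_eq_right (by linarith), max_eq_left (by linarith)]
      ring
    · rw [max_eq_left (by linarith), max_eq_right (by linarith)]
      ring
  linarith

lemma lagrangianAt_le_of_pointwise {n k : ℕ} (hn : 2 ≤ n) (hk : k ≤ n) {f : Marginals}
    (h1 : IsDist (f.one k)) (h0 : IsDist (f.zero k)) {p : ℝ} (hp : 0 ≤ p) (s : ℝ) {c d : ℝ}
    (hc : ∀ x ∈ Set.Icc (0 : ℝ) 1, 1 / 2 * max (x - s) 0 + multiplier p x * (1 - x) ≤ c)
    (hd : ∀ x ∈ Set.Icc (0 : ℝ) 1, 1 / 2 * max (x - s) 0 - multiplier p x * x ≤ d) :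
    lagrangianAt p n f k ≤ k * c + ((n : ℝ) - k) * d + s := by
  have hkn : (0 : ℝ) ≤ (n : ℝ) - k := sub_nonneg.2 (by exact_mod_cast hk)
  have i1 := (integrable_posPart_sub h1 s).const_mul (1 / 2)
  have i0 := (integrable_posPart_sub h0 s).const_mul (1 / 2)
  have j1 := integrable_multiplier_mul_one_sub hp h1
  have j0 := integrable_multiplier_mul hp h0
  have a1 := h1.integral_le (i1.add j1) hc
  have a0 := h0.integral_le (i0.sub j0) hd
  simp only [Pi.add_apply, Pi.sub_apply] at a1 a0
  rw [integral_add i1 j1, integral_const_mul] at a1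
  rw [integral_sub i0 j0, integral_const_mul] at a0
  have b := revenueAt_le hn hk h1 h0 s
  have c1 := mul_le_mul_of_nonneg_left a1 (Nat.cast_nonneg (α := ℝ) k)
  have c0 := mul_le_mul_of_nonneg_left a0 hkn
  unfold lagrangianAt
  linarith

lemma lagrangianAt_le {n k : ℕ} (hn : 2 ≤ n) (hk : k ≤ n) {f : Marginals}
    (h1 : IsDist (f.one k)) (h0 : IsDist (f.zero k)) {p : ℝ} (hp : 0 ≤ p) (hp' : p ≤ 1 / 2) :
    lagrangianAt p n f k ≤ 1 + ((k : ℝ) - 2) * p := by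
  -- The threshold `1 - 2p` is where the multiplier reaches its cap `1/2`; above it `(x-s)/2 +
  -- (1-x)/2` is constantly `p`.
  have key := lagrangianAt_le_of_pointwise hn hk h1 h0 hp (1 - 2 * p) (c := p) (d := 0) ?_ ?_
  · linarith
  · intro x hx
    rcases le_or_gt (1 - x) (2 * p) with h | h
    · rw [max_eq_left (by linarith), multiplier_of_le h]
      linarith
    · rw [max_eq_right (by linarith), multiplier_mul_of_lt hp h]
      linarith
  · intro x hx
    rcases le_or_gt (1 - x) (2 * p) with h | h
    · rw [max_eq_left (by linarith), multiplier_of_le h]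
      linarith
    · rw [max_eq_right (by linarith)]
      linarith [mul_nonneg (multiplier_nonneg hp x) hx.1]

lemma lagrangianAt_zero_le {n : ℕ} (hn : 2 ≤ n) {f : Marginals}
    (h1 : IsDist (f.one 0)) (h0 : IsDist (f.zero 0)) {q : ℝ} (hq : 0 ≤ q) (hq' : q ≤ 1) :
    lagrangianAt (q ^ 2 / 2) n f 0 ≤ (1 - q) ^ 2 := by
  have hp : 0 ≤ q ^ 2 / 2 := by positivity
  -- Any finite `c` will do, since it is multiplied by `k = 0`.
  have key := lagrangianAt_le_of_pointwise hn (Nat.zero_le n) h1 h0 hp ((1 - q) ^ 2)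
    (c := 1) (d := 0) ?_ ?_
  · simpa using key
  · intro x hx
    have := multiplier_mul_one_sub_le (x := x) hp
    have : max (x - (1 - q) ^ 2) 0 ≤ 1 := max_le (by nlinarith [hx.2, sq_nonneg (1 - q)]) (by simp)
    nlinarith
  · intro x hx
    suffices hs : max (x - (1 - q) ^ 2) 0 ≤ 2 * (multiplier (q ^ 2 / 2) x * x) by linarith
    refine max_le ?_ (mul_nonneg zero_le_two (mul_nonneg (multiplier_nonneg hp x) hx.1))
    rcases le_or_gt (1 - x) (2 * (q ^ 2 / 2)) with h | h
    · rw [multiplier_of_le h]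
      nlinarith [sq_nonneg (1 - q)]
    · have hm := multiplier_mul_of_lt hp h
      have hpos : 0 < 1 - x := by linarith
      refine le_of_mul_le_mul_right ?_ hpos
      have : 2 * (multiplier (q ^ 2 / 2) x * x) * (1 - x) = q ^ 2 * x := by
        linear_combination 2 * x * hm
      rw [this]
      -- After multiplication by `1 - x` the gap is exactly this square. The bound is tight at `x =
      -- 1 - q`, which corresponds to `t_0`.
      nlinarith [sq_nonneg (x - (1 - q))]

/-! ### Level one, where the domination constraint enters -/

lemma setIntegral_mono_of_le_on {F G : Measure ℝ} [IsFiniteMeasure F] [IsFiniteMeasure G] {c : ℝ}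
    (hc : 0 ≤ c) {S : Set ℝ} (hS : MeasurableSet S)
    (hle : ∀ B, MeasurableSet B → B ⊆ S → F.real B ≤ c * G.real B) {g : ℝ → ℝ}
    (hg : IntegrableOn g S G) (h0 : ∀ x ∈ S, 0 ≤ g x) :
    ∫ x in S, g x ∂F ≤ c * ∫ x in S, g x ∂G := by
  have hm : F.restrict S ≤ ENNReal.ofReal c • G.restrict S := by
    refine Measure.le_iff.2 fun B hB => ?_
    rw [Measure.smul_apply, Measure.restrict_apply hB, Measure.restrict_apply hB, smul_eq_mul,
      ← ofReal_measureReal, ← ofReal_measureReal (μ := G), ← ENNReal.ofReal_mul hc]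
    exact ENNReal.ofReal_le_ofReal (hle _ (hB.inter hS) Set.inter_subset_right)
  calc ∫ x in S, g x ∂F ≤ ∫ x, g x ∂(ENNReal.ofReal c • G.restrict S) :=
        integral_mono_measure hm
          (Measure.ae_smul_measure ((ae_restrict_iff' hS).2 (Filter.Eventually.of_forall h0)) _)
          (hg.smul_measure ENNReal.ofReal_ne_top)
    _ = c * ∫ x in S, g x ∂G := by
        rw [integral_smul_measure, ENNReal.toReal_ofReal hc, smul_eq_mul]

lemma multiplier_mono {p : ℝ} (hp : 0 ≤ p) : Monotone (multiplier p) := by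
  intro t x htx
  rcases le_or_gt (1 - x) (2 * p) with h | h
  · rw [multiplier_of_le h]
    exact multiplier_le_half hp t
  · rw [multiplier, multiplier, if_neg (by linarith), if_neg (by linarith)]
    exact div_le_div_of_nonneg_left hp (by linarith) (by linarith)

lemma multiplier_mul_of_le {p x : ℝ} (hp : 0 ≤ p) (h : 2 * p ≤ 1 - x) :
    multiplier p x * (1 - x) = p := by
  rcases h.lt_or_eq with h | h
  · exact multiplier_mul_of_lt hp h
  · rw [multiplier_of_le h.ge]
    linarith

lemma setIntegral_le_mul_measureReal {m : Measure ℝ} [IsFiniteMeasure m] {S : Set ℝ}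
    (hS : MeasurableSet S) {g : ℝ → ℝ} (hg : IntegrableOn g S m) {c : ℝ}
    (hle : ∀ x ∈ S, g x ≤ c) : ∫ x in S, g x ∂m ≤ c * m.real S := by
  calc ∫ x in S, g x ∂m ≤ ∫ _ in S, c ∂m :=
        setIntegral_mono_on hg (integrable_const c) hS hle
    _ = c * m.real S := by simp [mul_comm]

/-- Put `c = n - 1`. On `(t, 1]` the integrand for `F` is `p + (s + d)/2` and that for `G` is `(s -
d)/2 - τ`. As `d ≥ 0`, the domination `F ≤ cG` removes `d`. The common part `s` is at most `v - p -
t + τ` and meets total mass at most two. Finally `c G[t,1] ≥ 1`, because `F[t,1] ≤ 1` and the total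
on `[t, 1]` is at least two, so the term with `τ` costs at least `τ`. Everything adds up to `v`. -/
lemma lagrangianAt_one_le_of_low {n : ℕ} (hn : 2 ≤ n) {f : Marginals}
    (h1 : IsDist (f.one 1)) (h0 : IsDist (f.zero 1))
    (hdom : ∀ B : Set ℝ, MeasurableSet B → B ⊆ Set.Ioc (minSecmax n f 1) 1 →
      (f.one 1).real B ≤ ((n : ℝ) - 1) * (f.zero 1).real B)
    {p v : ℝ} (hp : 0 ≤ p) (hp' : p ≤ 1 / 2) (ht : minSecmax n f 1 ≤ 1 - 2 * p)
    (hv : ∀ x ∈ Set.Icc (0 : ℝ) (1 - 2 * p), p + x - multiplier p x * x ≤ v) :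
    lagrangianAt p n f 1 ≤ v := by
  obtain ⟨htm, hIcc, hIoc⟩ := minSecmax_spec hn (by omega : 1 ≤ n) h1 h0
  unfold lagrangianAt revenueAt
  set t := minSecmax n f 1
  have := h1.1
  have := h0.1
  have hc : (0 : ℝ) ≤ (n : ℝ) - 1 := by
    have : (2 : ℝ) ≤ n := by exact_mod_cast hn
    linarith
  simp only [Nat.cast_one, one_mul] at hIcc hIoc ⊢
  set F := f.one 1
  set G := f.zero 1
  set c : ℝ := (n : ℝ) - 1
  set τ := multiplier p t * t
  have hτ : 0 ≤ τ := mul_nonneg (multiplier_nonneg hp t) htm.1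
  have hφt : multiplier p t - p - τ = 0 := by
    have := multiplier_mul_of_le (x := t) hp (by linarith)
    simp only [τ]
    linarith
  set d : ℝ → ℝ := fun x => multiplier p x - p - τ
  set s : ℝ → ℝ := fun x => (x - t) + multiplier p x * (1 - x) - multiplier p x * x - p + τ
  -- Below the cap `multiplier p t * (1 - t) = p`, so `p + τ` is the multiplier at `t` and
  -- monotonicity gives the sign.
  have hd0 : ∀ x ∈ Set.Ioc t 1, 0 ≤ d x := fun x hx => by
    have := multiplier_mono hp hx.1.le
    simp only [d]
    linarith
  have hs : ∀ x ∈ Set.Ioc t 1, s x ≤ v - p - t + τ := fun x hx => by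
    simp only [s]
    rcases le_or_gt (1 - x) (2 * p) with h | h
    -- Where the multiplier is capped, `s` is constant, so the constraint at the endpoint `1 - 2p`,
    -- which reads `1/2 ≤ v`, suffices.
    · have hv' := hv (1 - 2 * p) ⟨by linarith, le_rfl⟩
      rw [multiplier_of_le (by linarith)] at hv'
      rw [multiplier_of_le h]
      linarith
    · have hv' := hv x ⟨by linarith [htm.1, hx.1], by linarith⟩
      have := multiplier_mul_of_lt hp h
      linarith
  have id : ∀ {m : Measure ℝ}, IsDist m → Integrable d m := fun hm => by
    have := hm.1
    exact ((integrable_multiplier hp hm).sub (integrable_const _)).sub (integrable_const _)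
  have is : ∀ {m : Measure ℝ}, IsDist m → Integrable s m := fun hm => by
    have := hm.1
    exact ((((integrable_sub hm t).add (integrable_multiplier_mul_one_sub hp hm)).sub
      (integrable_multiplier_mul hp hm)).sub (integrable_const _)).add (integrable_const _)
  have bF : 1 / 2 * (∫ x in Set.Icc t 1, (x - t) ∂F) + (∫ x, multiplier p x * (1 - x) ∂F)
      ≤ p + 1 / 2 * ((∫ x in Set.Ioc t 1, s x ∂F) + ∫ x in Set.Ioc t 1, d x ∂F) := by
    rw [← integral_indicator measurableSet_Icc, ← integral_add (is h1).integrableOn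
      (id h1).integrableOn, ← integral_indicator measurableSet_Ioc, ← integral_const_mul,
      ← integral_const_mul]
    have i1 := ((integrable_sub h1 t).indicator (measurableSet_Icc (a := t) (b := 1))).const_mul
      (1 / 2)
    have i2 := (((is h1).add (id h1)).indicator
      (measurableSet_Ioc (a := t) (b := 1))).const_mul (1 / 2)
    have e : p = ∫ _, p ∂F := by simp
    rw [← integral_add i1 (integrable_multiplier_mul_one_sub hp h1)]
    nth_rw 2 [e]
    refine (integral_mono_on_Icc h1.ae_mem (i1.add (integrable_multiplier_mul_one_sub hp h1))
      ((integrable_const p).add i2) fun x hx => ?_).trans_eq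
        (integral_add (integrable_const p) i2)
    simp only [Set.indicator_apply, Set.mem_Icc, Set.mem_Ioc, hx.2, and_true, Pi.add_apply]
    rcases lt_trichotomy x t with hxt | hxt | hxt
    · rw [if_neg (not_le.2 hxt), if_neg (not_lt.2 hxt.le)]
      linarith [multiplier_mul_one_sub_le (x := x) hp]
    · subst hxt
      simpa using multiplier_mul_one_sub_le hp
    · rw [if_pos hxt.le, if_pos hxt]
      simp only [s, d]
      linarith
  have bG : 1 / 2 * (∫ x in Set.Icc t 1, (x - t) ∂G) - (∫ x, multiplier p x * x ∂G)
      ≤ 1 / 2 * ((∫ x in Set.Ioc t 1, s x ∂G) - ∫ x in Set.Ioc t 1, d x ∂G)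
        - τ * G.real (Set.Icc t 1) := by
    have e : τ * G.real (Set.Icc t 1) = ∫ x, (Set.Icc t 1).indicator (fun _ => τ) x ∂G := by
      rw [integral_indicator measurableSet_Icc]
      simp [mul_comm]
    rw [e, ← integral_indicator measurableSet_Icc, ← integral_sub (is h0).integrableOn
      (id h0).integrableOn, ← integral_indicator measurableSet_Ioc, ← integral_const_mul,
      ← integral_const_mul]
    have i1 := ((integrable_sub h0 t).indicator (measurableSet_Icc (a := t) (b := 1))).const_mul
      (1 / 2)
    have i2 := (((is h0).sub (id h0)).indicator
      (measurableSet_Ioc (a := t) (b := 1))).const_mul (1 / 2)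
    have i3 : Integrable ((Set.Icc t 1).indicator (fun _ => τ)) G :=
      (integrable_const τ).indicator measurableSet_Icc
    rw [← integral_sub i1 (integrable_multiplier_mul hp h0)]
    refine (integral_mono_on_Icc h0.ae_mem (i1.sub (integrable_multiplier_mul hp h0))
      (i2.sub i3) fun x hx => ?_).trans_eq (integral_sub i2 i3)
    simp only [Set.indicator_apply, Set.mem_Icc, Set.mem_Ioc, hx.2, and_true, Pi.sub_apply]
    rcases lt_trichotomy x t with hxt | hxt | hxt
    · rw [if_neg (not_le.2 hxt), if_neg (not_lt.2 hxt.le), if_neg (not_le.2 hxt)]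
      linarith [mul_nonneg (multiplier_nonneg hp x) hx.1]
    · subst hxt
      simp [τ]
    · rw [if_pos hxt.le, if_pos hxt, if_pos hxt.le]
      simp only [s, d]
      linarith
  have bd := setIntegral_mono_of_le_on hc measurableSet_Ioc hdom (id h0).integrableOn hd0
  have bsF := setIntegral_le_mul_measureReal measurableSet_Ioc (is h1).integrableOn hs
  have bsG := mul_le_mul_of_nonneg_left
    (setIntegral_le_mul_measureReal measurableSet_Ioc (is h0).integrableOn hs) hc
  have bG' := mul_le_mul_of_nonneg_left bG hc
  have hF1 : F.real (Set.Icc t 1) ≤ 1 := measureReal_le_one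
  have hm : 0 ≤ v - p - t + τ := by
    have := hv t ⟨htm.1, ht⟩
    simp only [τ]
    linarith
  have c1 := mul_le_mul_of_nonneg_left hIoc hm
  have c2 := mul_le_mul_of_nonneg_left (by linarith : 1 ≤ c * G.real (Set.Icc t 1)) hτ
  linarith

/-- On `[t, 1]` the multiplier is constantly `1/2`, so the integrands are the constants `(1-t)/2`
and `-t/2`; elsewhere they are at most `p` and `0`. Only the masses of `[t, 1]` remain, and no
domination is needed. -/
lemma lagrangianAt_one_le_of_high {n : ℕ} (hn : 2 ≤ n) {f : Marginals}
    (h1 : IsDist (f.one 1)) (h0 : IsDist (f.zero 1))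
    {p : ℝ} (hp : 0 ≤ p) (hp' : p ≤ 1 / 2) (ht : 1 - 2 * p ≤ minSecmax n f 1) :
    lagrangianAt p n f 1 ≤ 1 / 2 := by
  obtain ⟨htm, hIcc, -⟩ := minSecmax_spec hn (by omega : 1 ≤ n) h1 h0
  unfold lagrangianAt revenueAt
  set t := minSecmax n f 1
  have := h1.1
  have := h0.1
  have hc : (0 : ℝ) ≤ (n : ℝ) - 1 := by
    have : (2 : ℝ) ≤ n := by exact_mod_cast hn
    linarith
  simp only [Nat.cast_one, one_mul] at hIcc ⊢
  set F := f.one 1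
  set G := f.zero 1
  set c : ℝ := (n : ℝ) - 1
  have bF : 1 / 2 * (∫ x in Set.Icc t 1, (x - t) ∂F) + (∫ x, multiplier p x * (1 - x) ∂F)
      ≤ p + ((1 - t) / 2 - p) * F.real (Set.Icc t 1) := by
    have e : ((1 - t) / 2 - p) * F.real (Set.Icc t 1)
        = ∫ x, (Set.Icc t 1).indicator (fun _ => (1 - t) / 2 - p) x ∂F := by
      rw [integral_indicator measurableSet_Icc]
      simp [mul_comm]
    have i1 := ((integrable_sub h1 t).indicator (measurableSet_Icc (a := t) (b := 1))).const_mul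
      (1 / 2)
    have i3 : Integrable ((Set.Icc t 1).indicator (fun _ => (1 - t) / 2 - p)) F :=
      (integrable_const _).indicator measurableSet_Icc
    have e' : p = ∫ _, p ∂F := by simp
    rw [e, ← integral_indicator measurableSet_Icc, ← integral_const_mul,
      ← integral_add i1 (integrable_multiplier_mul_one_sub hp h1)]
    nth_rw 2 [e']
    refine (integral_mono_on_Icc h1.ae_mem (i1.add (integrable_multiplier_mul_one_sub hp h1))
      ((integrable_const p).add i3) fun x hx => ?_).trans_eq
        (integral_add (integrable_const p) i3)
    simp only [Set.indicator_apply, Set.mem_Icc, hx.2, and_true, Pi.add_apply]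
    split_ifs with h
    · rw [multiplier_of_le (by linarith)]
      linarith
    · linarith [multiplier_mul_one_sub_le (x := x) hp]
  have bG : 1 / 2 * (∫ x in Set.Icc t 1, (x - t) ∂G) - (∫ x, multiplier p x * x ∂G)
      ≤ (-(t / 2)) * G.real (Set.Icc t 1) := by
    have e : (-(t / 2)) * G.real (Set.Icc t 1)
        = ∫ x, (Set.Icc t 1).indicator (fun _ => -(t / 2)) x ∂G := by
      rw [integral_indicator measurableSet_Icc]
      simp [mul_comm]
    have i1 := ((integrable_sub h0 t).indicator (measurableSet_Icc (a := t) (b := 1))).const_mul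
      (1 / 2)
    have i3 : Integrable ((Set.Icc t 1).indicator (fun _ => -(t / 2))) G :=
      (integrable_const _).indicator measurableSet_Icc
    rw [e, ← integral_indicator measurableSet_Icc, ← integral_const_mul,
      ← integral_sub i1 (integrable_multiplier_mul hp h0)]
    refine integral_mono_on_Icc h0.ae_mem (i1.sub (integrable_multiplier_mul hp h0)) i3
      fun x hx => ?_
    simp only [Set.indicator_apply, Set.mem_Icc, hx.2, and_true]
    split_ifs with h
    · rw [multiplier_of_le (by linarith)]
      linarith
    · linarith [mul_nonneg (multiplier_nonneg hp x) hx.1]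
  have bG' := mul_le_mul_of_nonneg_left bG hc
  have hF1 : F.real (Set.Icc t 1) ≤ 1 := measureReal_le_one
  have c1 := mul_le_mul_of_nonneg_left hIcc (by linarith [htm.1] : 0 ≤ t / 2)
  have c2 := mul_le_mul_of_nonneg_left hF1 (by linarith : 0 ≤ 1 / 2 - p)
  linarith

lemma lagrangianAt_one_le {n : ℕ} (hn : 2 ≤ n) {f : Marginals}
    (h1 : IsDist (f.one 1)) (h0 : IsDist (f.zero 1))
    (hdom : ∀ B : Set ℝ, MeasurableSet B → B ⊆ Set.Ioc (minSecmax n f 1) 1 →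
      (f.one 1).real B ≤ ((n : ℝ) - 1) * (f.zero 1).real B)
    {p v : ℝ} (hp : 0 ≤ p) (hp' : p ≤ 1 / 2)
    (hv : ∀ x ∈ Set.Icc (0 : ℝ) (1 - 2 * p), p + x - multiplier p x * x ≤ v) :
    lagrangianAt p n f 1 ≤ v := by
  rcases le_total (minSecmax n f 1) (1 - 2 * p) with ht | ht
  · exact lagrangianAt_one_le_of_low hn h1 h0 hdom hp hp' ht hv
  · have hv' := hv (1 - 2 * p) ⟨by linarith, le_rfl⟩
    rw [multiplier_of_le (by linarith)] at hv'
    linarith [lagrangianAt_one_le_of_high hn h1 h0 hp hp' ht]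

/-- The dual objective, in terms of bounds `v` for level one and `(1 - q)²` for level zero. -/
def dualValue {n : ℕ} (L : OutcomePrior n) (q v : ℝ) : ℝ :=
  lev L 1 * v + lev L 0 * (1 - q) ^ 2 + (∑ k ∈ Finset.Icc 2 n, lev L k) + q ^ 2 / 2 * slack L

/-- Dual feasibility. -/
structure IsDualFeasible (q v : ℝ) : Prop where
  nonneg : 0 ≤ q
  le_one : q ≤ 1
  le : ∀ x ∈ Set.Icc (0 : ℝ) (1 - 2 * (q ^ 2 / 2)),
    q ^ 2 / 2 + x - multiplier (q ^ 2 / 2) x * x ≤ v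

lemma sum_range_succ_eq_add_sum_Icc {n : ℕ} (hn : 2 ≤ n) (g : ℕ → ℝ) :
    ∑ k ∈ Finset.range (n + 1), g k = g 0 + g 1 + ∑ k ∈ Finset.Icc 2 n, g k := by
  have : Finset.Icc 2 n = Finset.Ico 2 (n + 1) := by
    ext
    simp only [Finset.mem_Icc, Finset.mem_Ico]
    omega
  rw [this, ← Finset.sum_range_add_sum_Ico _ (by omega : 2 ≤ n + 1), Finset.sum_range_succ,
    Finset.sum_range_one]

theorem revenue_le_dualValue {n : ℕ} (hn : 2 ≤ n) {L : OutcomePrior n} {f : Marginals}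
    (hf : f ∈ feasibleDagger L) {q v : ℝ} (h : IsDualFeasible q v) :
    revenue L f ≤ dualValue L q v := by
  have hp : 0 ≤ q ^ 2 / 2 := by positivity
  have hp' : q ^ 2 / 2 ≤ 1 / 2 := by nlinarith [h.nonneg, h.le_one]
  have hd := hf.1.1
  rw [revenue_eq_sum_lagrangianAt hf.1 hp, sum_range_succ_eq_add_sum_Icc hn]
  have b0 := mul_le_mul_of_nonneg_left (lagrangianAt_zero_le hn (hd 0 (by omega)).1
    (hd 0 (by omega)).2 h.nonneg h.le_one) (lev_nonneg L 0)
  have b1 := mul_le_mul_of_nonneg_left (lagrangianAt_one_le hn (hd 1 (by omega)).1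
    (hd 1 (by omega)).2 hf.2.1 hp hp' h.le) (lev_nonneg L 1)
  have b2 : ∑ k ∈ Finset.Icc 2 n, lev L k * lagrangianAt (q ^ 2 / 2) n f k
      ≤ (∑ k ∈ Finset.Icc 2 n, lev L k) + q ^ 2 / 2 * slack L := by
    unfold slack
    rw [Finset.mul_sum, ← Finset.sum_add_distrib]
    refine Finset.sum_le_sum fun k hk => ?_
    have hk' := (Finset.mem_Icc.1 hk).2
    have := mul_le_mul_of_nonneg_left
      (lagrangianAt_le hn hk' (hd k hk').1 (hd k hk').2 hp hp') (lev_nonneg L k)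
    linarith
  unfold dualValue
  linarith

/-! ### The two-variable program -/

section Program

variable {n : ℕ} (L : OutcomePrior n)

lemma slack_nonneg : 0 ≤ slack L :=
  Finset.sum_nonneg fun k hk => mul_nonneg
    (sub_nonneg.2 (by exact_mod_cast (Finset.mem_Icc.1 hk).1)) (lev_nonneg L k)

lemma xStar_nonneg : 0 ≤ xStar L := le_max_right _ _

lemma sqrt_two_bounds : 1 < Real.sqrt 2 ∧ Real.sqrt 2 < 3 / 2 ∧ Real.sqrt 2 * Real.sqrt 2 = 2 := by
  refine ⟨?_, ?_, Real.mul_self_sqrt zero_le_two⟩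
  · exact Real.lt_sqrt_of_sq_lt (by norm_num)
  · exact (Real.sqrt_lt' (by norm_num)).2 (by norm_num)

lemma xStar_le_slack : xStar L ≤ slack L := by
  have ha := lev_nonneg L 1
  have hb := lev_nonneg L 0
  have hA := slack_nonneg L
  obtain ⟨h1, -, -⟩ := sqrt_two_bounds
  have hs : 0 ≤ Real.sqrt 2 * lev L 0 := by positivity
  refine max_le (div_le_of_le_mul₀ (by positivity) hA ?_) hA
  nlinarith [mul_nonneg (mul_nonneg ha hb) (sub_nonneg.2 h1.le), mul_nonneg hs hA]

lemma xStar_lt_slack (h0 : 0 < lev L 0) (hA : 0 < slack L) : xStar L < slack L := by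
  have ha := lev_nonneg L 1
  obtain ⟨h1, -, -⟩ := sqrt_two_bounds
  have hs : 0 < Real.sqrt 2 * lev L 0 := by positivity
  refine max_lt ((div_lt_iff₀ (by positivity)).2 ?_) hA
  nlinarith [mul_nonneg (mul_nonneg ha h0.le) (sub_nonneg.2 h1.le), mul_pos hs hA]

lemma mem_programDomain_xStar : (xStar L, slack L - xStar L) ∈ programDomain L :=
  ⟨xStar_nonneg L, sub_nonneg.2 (xStar_le_slack L), by ring⟩

lemma convex_programDomain : Convex ℝ (programDomain L) := by
  rintro ⟨x, y⟩ ⟨hx, hy, hxy⟩ ⟨x', y'⟩ ⟨hx', hy', hxy'⟩ a b ha hb hab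
  simp only at hx hy hxy hx' hy' hxy'
  refine ⟨?_, ?_, ?_⟩
  · simp only [Prod.smul_mk, Prod.mk_add_mk, smul_eq_mul]
    positivity
  · simp only [Prod.smul_mk, Prod.mk_add_mk, smul_eq_mul]
    positivity
  · simp only [Prod.smul_mk, Prod.mk_add_mk, smul_eq_mul]
    linear_combination a * hxy + b * hxy' + slack L * hab

/-- `x ↦ c (d + x) / (e + x)` is concave on `x ≥ 0` if `d ≤ e`. -/
lemma concave_fraction {c d e : ℝ} (hc : 0 ≤ c) (he : 0 < e) (hde : d ≤ e) {x y a b : ℝ}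
    (hx : 0 ≤ x) (hy : 0 ≤ y) (ha : 0 ≤ a) (hb : 0 ≤ b) (hab : a + b = 1) :
    a * ((d + x) / (e + x) * c) + b * ((d + y) / (e + y) * c)
      ≤ (d + (a * x + b * y)) / (e + (a * x + b * y)) * c := by
  have h1 : 0 < e + x := by linarith
  have h2 : 0 < e + y := by linarith
  have h3 : 0 < e + (a * x + b * y) := by positivity
  have e1 : (d + x) / (e + x) = 1 - (e - d) * (e + x)⁻¹ := by field_simp; ring
  have e2 : (d + y) / (e + y) = 1 - (e - d) * (e + y)⁻¹ := by field_simp; ring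
  have e3 : (d + (a * x + b * y)) / (e + (a * x + b * y))
      = 1 - (e - d) * (e + (a * x + b * y))⁻¹ := by field_simp; ring
  have key : (e + (a * x + b * y))⁻¹ ≤ a * (e + x)⁻¹ + b * (e + y)⁻¹ := by
    have hconv := (convexOn_zpow (𝕜 := ℝ) (-1)).2 h1 h2 ha hb hab
    simp only [smul_eq_mul, zpow_neg_one] at hconv
    rwa [show a * (e + x) + b * (e + y) = e + (a * x + b * y) by
      linear_combination e * hab] at hconv
  rw [e1, e2, e3]
  have := mul_le_mul_of_nonneg_left key (mul_nonneg hc (sub_nonneg.2 hde))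
  linear_combination this + c * hab

lemma concaveOn_programValue : ConcaveOn ℝ (programDomain L) (programValue L) := by
  refine ⟨convex_programDomain L, ?_⟩
  rintro ⟨x, y⟩ ⟨hx, hy, -⟩ ⟨x', y'⟩ ⟨hx', hy', -⟩ a b ha hb hab
  simp only [programValue, Prod.smul_mk, Prod.mk_add_mk, smul_eq_mul] at *
  have k1 : a * ((lev L 1 + x) / (2 * lev L 1 + x) * lev L 1)
      + b * ((lev L 1 + x') / (2 * lev L 1 + x') * lev L 1)
      ≤ (lev L 1 + (a * x + b * x')) / (2 * lev L 1 + (a * x + b * x')) * lev L 1 := by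
    -- If the level has probability zero its denominator may vanish, but then the whole term is
    -- zero.
    rcases (lev_nonneg L 1).eq_or_lt with h | h
    · simp [← h]
    · exact concave_fraction h.le (by positivity) (by linarith) hx hx' ha hb hab
  have k0 : a * (y / (2 * lev L 0 + y) * lev L 0) + b * (y' / (2 * lev L 0 + y') * lev L 0)
      ≤ (a * y + b * y') / (2 * lev L 0 + (a * y + b * y')) * lev L 0 := by
    rcases (lev_nonneg L 0).eq_or_lt with h | h
    · simp [← h]
    · simpa using concave_fraction (d := 0) h.le (by positivity : 0 < 2 * lev L 0)
        (by positivity) hy hy' ha hb hab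
  linear_combination k1 + k0 + (∑ k ∈ Finset.Icc 2 n, lev L k) * hab

/-- Weak duality for the two-variable program. -/
lemma programValue_le_dualValue {P : ℝ × ℝ} (hP : P ∈ programDomain L) {q v : ℝ}
    (h : IsDualFeasible q v) : programValue L P ≤ dualValue L q v := by
  obtain ⟨x, y⟩ := P
  obtain ⟨hx, hy, hxy⟩ := hP
  simp only at hx hy hxy
  have hp : 0 ≤ q ^ 2 / 2 := by positivity
  have k1 : (lev L 1 + x) / (2 * lev L 1 + x) * lev L 1 ≤ lev L 1 * v + q ^ 2 / 2 * x := by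
    rcases (lev_nonneg L 1).eq_or_lt with h1 | h1
    · rw [← h1]
      simp
      positivity
    have hD : 0 < 2 * lev L 1 + x := by positivity
    have hle := h.le
    have hp' : 0 ≤ 1 - 2 * (q ^ 2 / 2) := by nlinarith [h.nonneg, h.le_one]
    generalize q ^ 2 / 2 = p at hp hle hp' ⊢
    -- The bid `t` serves as coordinate in place of `x`, through `x (1 - t) = λ_1 (2t - 1)`; the
    -- dual constraint at this `t` is the one needed.
    set t := (lev L 1 + x) / (2 * lev L 1 + x) with ht
    have htD : t * (2 * lev L 1 + x) = lev L 1 + x := div_mul_cancel₀ _ hD.ne'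
    have ht0 : 0 ≤ t := by positivity
    have h1t : (1 - t) * (2 * lev L 1 + x) = lev L 1 := by linear_combination -htD
    have ht1 : 0 < 1 - t := by
      by_contra hcon
      nlinarith [mul_nonneg (neg_nonneg.2 (not_lt.1 hcon)) hD.le]
    have hxt : x * (1 - t) = lev L 1 * (2 * t - 1) := by linear_combination h1t
    have ht2 : 0 ≤ 2 * t - 1 := by
      by_contra hcon
      nlinarith [mul_pos h1 (neg_pos.2 (not_le.1 hcon)), mul_nonneg hx ht1.le]
    rcases le_total t (1 - 2 * p) with htp | htp
    · have hv := hle t ⟨ht0, htp⟩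
      have hm := multiplier_mul_of_le (x := t) hp (by linarith)
      have hxe : p * x = lev L 1 * (multiplier p t * (2 * t - 1)) := by
        refine mul_right_cancel₀ ht1.ne' ?_
        linear_combination p * hxt - lev L 1 * (2 * t - 1) * hm
      rw [hxe]
      have := mul_le_mul_of_nonneg_left hv h1.le
      linear_combination this + lev L 1 * hm
    · have hv := hle (1 - 2 * p) ⟨hp', le_rfl⟩
      rw [multiplier_of_le (by linarith)] at hv
      have hv' : 1 / 2 ≤ v := by linarith
      have hxe : lev L 1 * (2 * t - 1) / 2 ≤ p * x := by
        nlinarith [mul_nonneg hx (by linarith : 0 ≤ 2 * p - (1 - t))]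
      nlinarith [mul_le_mul_of_nonneg_left hv' h1.le]
  have k0 : y / (2 * lev L 0 + y) * lev L 0 ≤ lev L 0 * (1 - q) ^ 2 + q ^ 2 / 2 * y := by
    rcases (lev_nonneg L 0).eq_or_lt with h0 | h0
    · rw [← h0]
      simp
      positivity
    have hD : 0 < 2 * lev L 0 + y := by positivity
    rw [div_mul_eq_mul_div, div_le_iff₀ hD]
    have : 0 ≤ 1 / 2 * (2 * lev L 0 - q * (2 * lev L 0 + y)) ^ 2 := by positivity
    linear_combination this
  unfold programValue dualValue
  rw [← hxy]
  linear_combination k1 + k0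

/-- A bound for the dual function of level one, valid for all `p = r²`. -/
lemma add_sub_multiplier_mul_le {r x : ℝ} (hr : 0 ≤ r) (hx : x ≤ 1 - 2 * r ^ 2) (hx' : x ≤ 1) :
    r ^ 2 + x - multiplier (r ^ 2) x * x ≤ r ^ 2 + (1 - r) ^ 2 := by
  have hm := multiplier_mul_of_le (p := r ^ 2) (x := x) (by positivity) (by linarith)
  rcases hx'.eq_or_lt with rfl | hlt
  · have : r = 0 := by nlinarith
    subst this
    rw [multiplier_of_le (by norm_num)]
    norm_num
  · refine le_of_mul_le_mul_right ?_ (by linarith : 0 < 1 - x)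
    -- The gap times `1 - x`; the maximum of the left side is at `x = 1 - r`.
    have : 0 ≤ (1 - x - r) ^ 2 := by positivity
    linear_combination this - x * hm

/-- For `p ≥ 1/4` the unconstrained maximiser `1 - √p` is not below `1 - 2p`, so the maximum is at
this endpoint, with value `1/2`. -/
lemma add_sub_multiplier_mul_le_half {p x : ℝ} (hp : 1 / 4 ≤ p) (hx : x ≤ 1 - 2 * p) :
    p + x - multiplier p x * x ≤ 1 / 2 := by
  have hm := multiplier_mul_of_le (p := p) (x := x) (by linarith) (by linarith)
  refine le_of_mul_le_mul_right ?_ (by linarith : 0 < 1 - x)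
  have : 0 ≤ (1 - x - 2 * p) * (1 - x - 1 / 2) := mul_nonneg (by linarith) (by linarith)
  linear_combination this - x * hm

/-- Strong duality. -/
lemma exists_dualValue_le :
    ∃ q v, IsDualFeasible q v ∧
      dualValue L q v ≤ programValue L (xStar L, slack L - xStar L) := by
  have ha := lev_nonneg L 1
  have hb := lev_nonneg L 0
  have hA := slack_nonneg L
  obtain ⟨s1, s2, s3⟩ := sqrt_two_bounds
  rcases (xStar_nonneg L).eq_or_lt with hx | hx
  · rw [← hx]
    have hnum : (lev L 1 * slack L + 2 * lev L 1 * lev L 0 * (1 - Real.sqrt 2))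
        / (lev L 1 + Real.sqrt 2 * lev L 0) ≤ 0 := by
      rw [hx]
      exact le_max_left _ _
    rcases hb.eq_or_lt with hb0 | hb0
    · rcases ha.eq_or_lt with ha0 | ha0
      · refine ⟨0, 1, ⟨le_rfl, zero_le_one, fun x hx => ?_⟩, ?_⟩
        · have := add_sub_multiplier_mul_le (r := 0) (x := x) le_rfl (by simpa using hx.2)
            (by simpa using hx.2)
          simpa using this
        · simp [dualValue, programValue, ← hb0, ← ha0]
      · have hA0 : slack L = 0 := by
          rw [← hb0] at hnum
          simp only [mul_zero, zero_mul, add_zero] at hnum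
          rw [mul_div_cancel_left₀ _ ha0.ne'] at hnum
          exact le_antisymm hnum hA
        refine ⟨1, 1 / 2, ⟨zero_le_one, le_rfl, fun x hx => ?_⟩, ?_⟩
        · exact add_sub_multiplier_mul_le_half (by norm_num) hx.2
        · have : lev L 1 / (2 * lev L 1) * lev L 1 = lev L 1 * (1 / 2) := by field_simp
          simp [dualValue, programValue, ← hb0, hA0, this]
    -- Corner `x = 0`, `y = A`: here `w = 1 - t_0`, and `q = w` prices the resource at the marginal
    -- value of `y`.
    · set w := 2 * lev L 0 / (2 * lev L 0 + slack L) with hw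
      have hD : 0 < 2 * lev L 0 + slack L := by positivity
      have hwD : w * (2 * lev L 0 + slack L) = 2 * lev L 0 := div_mul_cancel₀ _ hD.ne'
      have hw0 : 0 < w := by positivity
      have hw1 : w ≤ 1 := by
        rw [hw, div_le_one hD]
        linarith
      have hq : slack L / (2 * lev L 0 + slack L) * lev L 0
          = lev L 0 * (1 - w) ^ 2 + w ^ 2 / 2 * slack L := by
        have : slack L / (2 * lev L 0 + slack L) = 1 - w := by
          rw [hw]
          field_simp
          ring
        rw [this]
        linear_combination -w / 2 * hwD
      rcases ha.eq_or_lt with ha0 | ha0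
      -- With `λ_1 = 0` the value of `v` carries no weight; `2` is merely feasible.
      · refine ⟨w, 2, ⟨hw0.le, hw1, fun x hx => ?_⟩, ?_⟩
        · have := mul_nonneg (multiplier_nonneg (by positivity : 0 ≤ w ^ 2 / 2) x) hx.1
          nlinarith [hx.2]
        · simp only [dualValue, programValue, sub_zero, hq, ← ha0]
          linarith
      · refine ⟨w, 1 / 2, ⟨hw0.le, hw1, fun x hx => ?_⟩, ?_⟩
        · refine add_sub_multiplier_mul_le_half ?_ hx.2
          have hden : 0 < lev L 1 + Real.sqrt 2 * lev L 0 := by positivity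
          have h1 := not_lt.1 fun h => not_lt.2 hnum (div_pos h hden)
          -- The nonpositive numerator of `x*` is equivalent to `w √2 ≥ 1`, that is `p = w²/2 ≥
          -- 1/4`: the corner condition is dual feasibility of `v = 1/2`.
          have h2 : 2 * lev L 0 + slack L ≤ 2 * lev L 0 * Real.sqrt 2 := by
            by_contra hcon
            nlinarith [mul_pos ha0 (sub_pos.2 (not_le.1 hcon))]
          have h3 : 1 ≤ w * Real.sqrt 2 := by
            by_contra hcon
            nlinarith [mul_le_mul_of_nonneg_left h2 hw0.le, mul_pos hb0 (sub_pos.2 (not_le.1 hcon))]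
          nlinarith
        · have : lev L 1 / (2 * lev L 1) * lev L 1 = lev L 1 * (1 / 2) := by field_simp
          simp only [dualValue, programValue, sub_zero, hq, add_zero, this]
          linarith
  · have hxe : xStar L = (lev L 1 * slack L + 2 * lev L 1 * lev L 0 * (1 - Real.sqrt 2))
        / (lev L 1 + Real.sqrt 2 * lev L 0) := by
      rcases max_choice ((lev L 1 * slack L + 2 * lev L 1 * lev L 0 * (1 - Real.sqrt 2))
        / (lev L 1 + Real.sqrt 2 * lev L 0)) 0 with h | h
      · exact h
      · exact absurd h hx.ne'
    have ha0 : 0 < lev L 1 := by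
      rcases ha.eq_or_lt with h | h
      · rw [hxe, ← h] at hx
        simp at hx
      · exact h
    have hden : 0 < lev L 1 + Real.sqrt 2 * lev L 0 := by positivity
    set D := lev L 1 + Real.sqrt 2 * lev L 0 with hDdef
    set S := 2 * lev L 1 + 2 * lev L 0 + slack L with hSdef
    have hS : 0 < S := by positivity
    have hxD : xStar L * D
        = lev L 1 * slack L + 2 * lev L 1 * lev L 0 * (1 - Real.sqrt 2) := by
      rw [hxe, div_mul_cancel₀ _ hden.ne']
    have hX : (2 * lev L 1 + xStar L) * D = lev L 1 * S := by
      rw [add_mul, hxD, hDdef, hSdef]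
      ring
    have hY : (2 * lev L 0 + (slack L - xStar L)) * D = lev L 0 * (Real.sqrt 2 * S) := by
      have : 2 * lev L 0 + (slack L - xStar L) = S - (2 * lev L 1 + xStar L) := by
        rw [hSdef]
        ring
      rw [this, sub_mul, hX, hDdef]
      ring
    -- Interior optimum: the marginal values `λ_1²/(2λ_1+x)²` and, if `λ_0 > 0`, `2λ_0²/(2λ_0+y)²`
    -- agree and equal `z²`. So `z = 1 - t_1`, `√2 z = 1 - t_0`, and the price is `p = z²`.
    set z := D / S with hz
    have hzS : z * S = D := div_mul_cancel₀ _ hS.ne'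
    have hz0 : 0 < z := by positivity
    have hz2 : z ≤ 1 / 2 := by
      have hXz : (2 * lev L 1 + xStar L) * z = lev L 1 := by
        refine mul_right_cancel₀ hS.ne' ?_
        rw [mul_assoc, hzS, hX]
      nlinarith
    have hXz : (2 * lev L 1 + xStar L) * z = lev L 1 := by
      refine mul_right_cancel₀ hS.ne' ?_
      rw [mul_assoc, hzS, hX]
    have hYz : (2 * lev L 0 + (slack L - xStar L)) * z = lev L 0 * Real.sqrt 2 := by
      refine mul_right_cancel₀ hS.ne' ?_
      rw [mul_assoc, hzS, hY]
      ring
    have hXpos : 0 < 2 * lev L 1 + xStar L := by positivity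
    have v1 : (lev L 1 + xStar L) / (2 * lev L 1 + xStar L) = 1 - z := by
      rw [div_eq_iff hXpos.ne']
      linear_combination hXz
    have v0 : (slack L - xStar L) / (2 * lev L 0 + (slack L - xStar L)) * lev L 0
        = (1 - Real.sqrt 2 * z) * lev L 0 := by
      rcases hb.eq_or_lt with h | h
      · simp [← h]
      · have hYpos : 0 < 2 * lev L 0 + (slack L - xStar L) := by
          have := xStar_le_slack L
          linarith
        congr 1
        rw [div_eq_iff hYpos.ne']
        linear_combination Real.sqrt 2 * hYz + lev L 0 * s3
    have hp : (Real.sqrt 2 * z) ^ 2 / 2 = z ^ 2 := by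
      linear_combination z ^ 2 / 2 * s3
    refine ⟨Real.sqrt 2 * z, z ^ 2 + (1 - z) ^ 2, ⟨by positivity, by nlinarith, fun x hx => ?_⟩, ?_⟩
    · rw [hp] at hx ⊢
      exact add_sub_multiplier_mul_le hz0.le hx.2 (by nlinarith [hx.2, sq_nonneg z])
    · simp only [dualValue, programValue, v1, v0, hp]
      have e : z ^ 2 * slack L = z * D - 2 * z ^ 2 * lev L 1 - 2 * z ^ 2 * lev L 0 := by
        rw [hSdef] at hzS
        linear_combination z * hzS
      rw [e, hDdef]
      refine le_of_eq ?_
      linear_combination z ^ 2 * lev L 0 * s3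

lemma isMaxOn_programValue :
    IsMaxOn (programValue L) (programDomain L) (xStar L, slack L - xStar L) := by
  obtain ⟨q, v, hf, hle⟩ := exists_dualValue_le L
  exact fun P hP => (programValue_le_dualValue L hP hf).trans hle

/-! ### Solvability of the linear system -/

/-- The solution of the linear system that splits every `(k - 2) / k` in the same proportion. -/
lemma linSysWeak_proportional {θ : ℝ} (h0 : 0 ≤ θ) (h1 : θ ≤ 1)
    (hθ : θ * slack L = xStar L) :
    LinSysWeak L (fun k => θ * (((k : ℝ) - 2) / k)) (fun k => (1 - θ) * (((k : ℝ) - 2) / k)) := by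
  have hnn : ∀ k ∈ Finset.Icc 2 n, (0 : ℝ) ≤ ((k : ℝ) - 2) / k := fun k hk =>
    div_nonneg (sub_nonneg.2 (by exact_mod_cast (Finset.mem_Icc.1 hk).1)) k.cast_nonneg
  have hw : ∀ c : ℝ, weight L (fun k => c * (((k : ℝ) - 2) / k)) = c * slack L := fun c => by
    unfold weight slack
    rw [Finset.mul_sum]
    refine Finset.sum_congr rfl fun k hk => ?_
    have : (k : ℝ) ≠ 0 := by
      have := (Finset.mem_Icc.1 hk).1
      positivity
    field_simp
  refine ⟨fun k hk => ⟨mul_nonneg h0 (hnn k hk), mul_nonneg (by linarith) (hnn k hk)⟩,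
    fun k _ => by ring, ?_, ?_⟩
  · rw [hw, hθ]
  · rw [hw, hw]
    ring

lemma exists_linSysWeak : ∃ bh bl : ℕ → ℝ, LinSysWeak L bh bl := by
  rcases (slack_nonneg L).eq_or_lt with hA | hA
  · refine ⟨_, _, linSysWeak_proportional L le_rfl zero_le_one ?_⟩
    have := xStar_le_slack L
    rw [zero_mul]
    linarith [xStar_nonneg L]
  · exact ⟨_, _, linSysWeak_proportional L (div_nonneg (xStar_nonneg L) hA.le)
      ((div_le_one hA).2 (xStar_le_slack L)) (div_mul_cancel₀ _ hA.ne')⟩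

/-- The proportional split has `b^l_n = (1-θ)(n-2)/n`; this is positive because `λ_0 > 0` forces `x*
< A` when `A > 0`, and `θ = 0` is taken when `A = 0`. -/
lemma exists_linSys (hn : 3 ≤ n) (h0 : 0 < lev L 0) : ∃ bh bl : ℕ → ℝ, LinSys L bh bl := by
  have hn' : (3 : ℝ) ≤ n := by exact_mod_cast hn
  have hpos : 0 < ((n : ℝ) - 2) / n := div_pos (by linarith) (by linarith)
  rcases (slack_nonneg L).eq_or_lt with hA | hA
  · refine ⟨_, _, linSysWeak_proportional L le_rfl zero_le_one ?_, ?_⟩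
    · have := xStar_le_slack L
      rw [zero_mul]
      linarith [xStar_nonneg L]
    · simpa using hpos
  · refine ⟨_, _, linSysWeak_proportional L (div_nonneg (xStar_nonneg L) hA.le)
      ((div_le_one hA).2 (xStar_le_slack L)) (div_mul_cancel₀ _ hA.ne'), ?_⟩
    exact mul_pos (sub_pos.2 ((div_lt_one hA).2 (xStar_lt_slack L h0 hA))) hpos

end Program

/-! ### The explicit marginals -/

section Explicit

variable {n : ℕ} {L : OutcomePrior n} {bh bl : ℕ → ℝ}

lemma LinSysWeak.weight_low (h : LinSysWeak L bh bl) : weight L bl = slack L - xStar L := by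
  rw [← h.weight_total, h.weight_high]
  ring

lemma xStar_eq_zero_of_lev_one_eq_zero (h : lev L 1 = 0) : xStar L = 0 := by
  simp [xStar, h]

/-- This is calibration at the atom `t_1*`, in a form that survives `0/0`: if `λ_1 = 0` then `x* =
0` and both sides vanish. -/
lemma LinSysWeak.tOne_mul (h : LinSysWeak L bh bl) :
    tOne L bh * (2 * lev L 1 + weight L bh) = lev L 1 + weight L bh := by
  unfold tOne
  rcases (lev_nonneg L 1).eq_or_lt with h1 | h1
  · rw [h.weight_high, xStar_eq_zero_of_lev_one_eq_zero h1.symm, ← h1]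
    simp
  · have := h.weight_high ▸ xStar_nonneg L
    exact div_mul_cancel₀ _ (by positivity)

lemma LinSysWeak.weight_low_nonneg (h : LinSysWeak L bh bl) : 0 ≤ weight L bl := by
  rw [h.weight_low]
  linarith [xStar_le_slack L]

lemma LinSysWeak.tZero_mul (h : LinSysWeak L bh bl) :
    tZero L bl * (2 * lev L 0 + weight L bl) = weight L bl := by
  unfold tZero
  have hw := h.weight_low_nonneg
  have hb := lev_nonneg L 0
  rcases (by positivity : 0 ≤ 2 * lev L 0 + weight L bl).eq_or_lt with h1 | h1
  · rw [← h1, mul_zero]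
    linarith
  · exact div_mul_cancel₀ _ h1.ne'

lemma LinSysWeak.tOne_mem (h : LinSysWeak L bh bl) : tOne L bh ∈ Set.Icc (0 : ℝ) 1 := by
  have h1 := lev_nonneg L 1
  have hw := h.weight_high ▸ xStar_nonneg L
  exact ⟨div_nonneg (by positivity) (by positivity),
    div_le_one_of_le₀ (by linarith) (by positivity)⟩

lemma LinSysWeak.tZero_mem (h : LinSysWeak L bh bl) : tZero L bl ∈ Set.Icc (0 : ℝ) 1 := by
  have h0 := lev_nonneg L 0
  have hw := h.weight_low_nonneg
  exact ⟨div_nonneg (by positivity) (by positivity),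
    div_le_one_of_le₀ (by linarith) (by positivity)⟩

lemma optMarginals_one_zero : (optMarginals L bh bl).one 0 = Measure.dirac 0 := rfl

lemma optMarginals_one_one : (optMarginals L bh bl).one 1 = Measure.dirac (tOne L bh) := rfl

lemma optMarginals_one_of_two_le {k : ℕ} (hk : 2 ≤ k) :
    (optMarginals L bh bl).one k = ENNReal.ofReal (2 / (k : ℝ)) • Measure.dirac 1
      + ENNReal.ofReal (bh k) • Measure.dirac (tOne L bh)
      + ENNReal.ofReal (bl k) • Measure.dirac (tZero L bl) := by
  simp only [optMarginals]
  rw [if_neg (by omega), if_neg (by omega)]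

lemma optMarginals_zero_zero : (optMarginals L bh bl).zero 0
    = ENNReal.ofReal (2 / (n : ℝ)) • Measure.dirac (tZero L bl)
      + ENNReal.ofReal (((n : ℝ) - 2) / n) • Measure.dirac 0 := rfl

lemma optMarginals_zero_one : (optMarginals L bh bl).zero 1
    = ENNReal.ofReal (1 / ((n : ℝ) - 1)) • Measure.dirac (tOne L bh)
      + ENNReal.ofReal (((n : ℝ) - 2) / ((n : ℝ) - 1)) • Measure.dirac 0 := rfl

lemma optMarginals_zero_of_two_le {k : ℕ} (hk : 2 ≤ k) :
    (optMarginals L bh bl).zero k = Measure.dirac 0 := by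
  simp only [optMarginals]
  rw [if_neg (by omega), if_neg (by omega)]

lemma integrable_ofReal_smul_dirac (g : ℝ → ℝ) (c a : ℝ) :
    Integrable g (ENNReal.ofReal c • Measure.dirac a) :=
  (integrable_dirac (by simp)).smul_measure ENNReal.ofReal_ne_top

lemma integral_ofReal_smul_dirac (g : ℝ → ℝ) {c : ℝ} (hc : 0 ≤ c) (a : ℝ) :
    ∫ x, g x ∂(ENNReal.ofReal c • Measure.dirac a) = c * g a := by
  rw [integral_smul_measure, integral_dirac, ENNReal.toReal_ofReal hc, smul_eq_mul]

lemma integral_two_atoms (g : ℝ → ℝ) {c d : ℝ} (hc : 0 ≤ c) (hd : 0 ≤ d) (a b : ℝ) :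
    ∫ x, g x ∂(ENNReal.ofReal c • Measure.dirac a + ENNReal.ofReal d • Measure.dirac b)
      = c * g a + d * g b := by
  rw [integral_add_measure (integrable_ofReal_smul_dirac g c a)
    (integrable_ofReal_smul_dirac g d b), integral_ofReal_smul_dirac g hc,
    integral_ofReal_smul_dirac g hd]

lemma integral_optMarginals_one (h : LinSysWeak L bh bl) {k : ℕ} (hk : 2 ≤ k) (hkn : k ≤ n)
    (g : ℝ → ℝ) : ∫ x, g x ∂((optMarginals L bh bl).one k)
      = 2 / k * g 1 + bh k * g (tOne L bh) + bl k * g (tZero L bl) := by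
  obtain ⟨b1, b2⟩ := h.nonneg k (Finset.mem_Icc.2 ⟨hk, hkn⟩)
  rw [optMarginals_one_of_two_le hk, integral_add_measure
    ((integrable_ofReal_smul_dirac g _ _).add_measure (integrable_ofReal_smul_dirac g _ _))
    (integrable_ofReal_smul_dirac g _ _), integral_two_atoms g (by positivity) b1,
    integral_ofReal_smul_dirac g b2]

lemma integral_optMarginals_zero_zero (hn : 2 ≤ n) (g : ℝ → ℝ) :
    ∫ x, g x ∂((optMarginals L bh bl).zero 0)
      = 2 / n * g (tZero L bl) + ((n : ℝ) - 2) / n * g 0 := by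
  have hn' : (2 : ℝ) ≤ n := by exact_mod_cast hn
  rw [optMarginals_zero_zero, integral_two_atoms g (by positivity)
    (div_nonneg (by linarith) (by linarith))]

lemma integral_optMarginals_zero_one (hn : 2 ≤ n) (g : ℝ → ℝ) :
    ∫ x, g x ∂((optMarginals L bh bl).zero 1)
      = 1 / ((n : ℝ) - 1) * g (tOne L bh) + ((n : ℝ) - 2) / ((n : ℝ) - 1) * g 0 := by
  have hn' : (2 : ℝ) ≤ n := by exact_mod_cast hn
  rw [optMarginals_zero_one, integral_two_atoms g (div_nonneg (by linarith) (by linarith))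
    (div_nonneg (by linarith) (by linarith))]

lemma measureReal_eq_integral_indicator (m : Measure ℝ) {B : Set ℝ} (hB : MeasurableSet B) :
    m.real B = ∫ x, B.indicator (fun _ => (1 : ℝ)) x ∂m := by
  rw [integral_indicator hB]
  simp

lemma isDist_dirac {a : ℝ} (ha : a ∈ Set.Icc (0 : ℝ) 1) : IsDist (Measure.dirac a) := by
  refine ⟨inferInstance, ?_⟩
  rw [Measure.dirac_apply' _ measurableSet_Icc.compl]
  simp only [Set.indicator_apply_eq_zero]
  exact fun h => absurd ha h

lemma isDist_two_atoms {a b c d : ℝ} (ha : a ∈ Set.Icc (0 : ℝ) 1) (hb : b ∈ Set.Icc (0 : ℝ) 1)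
    (hc : 0 ≤ c) (hd : 0 ≤ d) (hcd : c + d = 1) :
    IsDist (ENNReal.ofReal c • Measure.dirac a + ENNReal.ofReal d • Measure.dirac b) := by
  refine ⟨⟨?_⟩, ?_⟩
  · simp [← ENNReal.ofReal_add hc hd, hcd]
  · simp [(isDist_dirac ha).2, (isDist_dirac hb).2]

lemma isDist_three_atoms {a b e c d w : ℝ} (ha : a ∈ Set.Icc (0 : ℝ) 1)
    (hb : b ∈ Set.Icc (0 : ℝ) 1) (he : e ∈ Set.Icc (0 : ℝ) 1)
    (hc : 0 ≤ c) (hd : 0 ≤ d) (hw : 0 ≤ w) (hcd : c + d + w = 1) :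
    IsDist (ENNReal.ofReal c • Measure.dirac a + ENNReal.ofReal d • Measure.dirac b
      + ENNReal.ofReal w • Measure.dirac e) := by
  refine ⟨⟨?_⟩, ?_⟩
  · simp [← ENNReal.ofReal_add hc hd, ← ENNReal.ofReal_add (add_nonneg hc hd) hw, hcd]
  · simp [(isDist_dirac ha).2, (isDist_dirac hb).2, (isDist_dirac he).2]

lemma isDist_optMarginals (hn : 2 ≤ n) (h : LinSysWeak L bh bl) {k : ℕ} (hk : k ≤ n) :
    IsDist ((optMarginals L bh bl).one k) ∧ IsDist ((optMarginals L bh bl).zero k) := by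
  have hn' : (2 : ℝ) ≤ n := by exact_mod_cast hn
  have h0 : (0 : ℝ) ∈ Set.Icc (0 : ℝ) 1 := by simp
  have h1 : (1 : ℝ) ∈ Set.Icc (0 : ℝ) 1 := by simp
  obtain rfl | rfl | hk2 : k = 0 ∨ k = 1 ∨ 2 ≤ k := by omega
  · refine ⟨isDist_dirac h0, ?_⟩
    rw [optMarginals_zero_zero]
    exact isDist_two_atoms h.tZero_mem h0 (by positivity) (div_nonneg (by linarith) (by linarith))
      (by field_simp; ring)
  · refine ⟨isDist_dirac h.tOne_mem, ?_⟩
    rw [optMarginals_zero_one]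
    have : (n : ℝ) - 1 ≠ 0 := by linarith
    exact isDist_two_atoms h.tOne_mem h0 (div_nonneg (by linarith) (by linarith))
      (div_nonneg (by linarith) (by linarith)) (by field_simp; ring)
  · rw [optMarginals_one_of_two_le hk2, optMarginals_zero_of_two_le hk2]
    have hmem := Finset.mem_Icc.2 ⟨hk2, hk⟩
    have hk0 : (k : ℝ) ≠ 0 := by positivity
    refine ⟨isDist_three_atoms h1 h.tOne_mem h.tZero_mem (by positivity) (h.nonneg k hmem).1
      (h.nonneg k hmem).2 ?_, isDist_dirac h0⟩
    rw [add_assoc, h.add_eq k hmem]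
    field_simp
    ring

/-- Integrals reduce to values at the atoms. The signal `1` comes only from outcome `1`, the signal
`0` adds nothing to the `x`-weighted side, and the other two atoms balance by `tOne_mul` and
`tZero_mul`. -/
lemma calibrated_optMarginals (hn : 2 ≤ n) (h : LinSysWeak L bh bl) :
    Calibrated L (optMarginals L bh bl) := by
  intro B hB
  have hn' : (2 : ℝ) ≤ n := by exact_mod_cast hn
  have hn1 : (n : ℝ) - 1 ≠ 0 := by linarith
  have hn0 : (n : ℝ) ≠ 0 := by linarith
  set i : ℝ → ℝ := B.indicator fun _ => 1 with hi
  have hBx : ∀ m : Measure ℝ, ∫ x in B, x ∂m = ∫ x, x * i x ∂m := fun m => by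
    rw [← integral_indicator hB]
    refine integral_congr_ae (Filter.Eventually.of_forall fun x => ?_)
    by_cases hx : x ∈ B <;> simp [hi, hx]
  simp only [hBx, measureReal_eq_integral_indicator _ hB]
  have hI : Finset.Icc 1 n = insert 1 (Finset.Icc 2 n) := by
    ext
    simp only [Finset.mem_Icc, Finset.mem_insert]
    omega
  have hR : Finset.range n = insert 0 (insert 1 (Finset.Ico 2 n)) := by
    ext
    simp only [Finset.mem_range, Finset.mem_Ico, Finset.mem_insert]
    omega
  rw [hI, hR, Finset.sum_insert (by simp), Finset.sum_insert (by simp),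
    Finset.sum_insert (by simp), Finset.sum_insert (by simp),
    integral_optMarginals_zero_zero hn, integral_optMarginals_zero_one hn, optMarginals_one_one,
    integral_dirac, integral_dirac]
  have e0 : ∑ k ∈ Finset.Ico 2 n, lev L k * ((n : ℝ) - k)
      * ∫ x, x * i x ∂((optMarginals L bh bl).zero k) = 0 := by
    refine Finset.sum_eq_zero fun k hk => ?_
    rw [optMarginals_zero_of_two_le (Finset.mem_Ico.1 hk).1, integral_dirac]
    ring
  have e1 : ∀ g : ℝ → ℝ, ∑ k ∈ Finset.Icc 2 n, lev L k * k
      * ∫ x, g x ∂((optMarginals L bh bl).one k)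
      = 2 * (∑ k ∈ Finset.Icc 2 n, lev L k) * g 1 + weight L bh * g (tOne L bh)
        + weight L bl * g (tZero L bl) := fun g => by
    unfold weight
    rw [Finset.mul_sum, Finset.sum_mul, Finset.sum_mul, Finset.sum_mul,
      ← Finset.sum_add_distrib, ← Finset.sum_add_distrib]
    refine Finset.sum_congr rfl fun k hk => ?_
    obtain ⟨hk2, hkn⟩ := Finset.mem_Icc.1 hk
    rw [integral_optMarginals_one h hk2 hkn]
    have : (k : ℝ) ≠ 0 := by positivity
    field_simp
  rw [e0, e1 fun x => x * i x, e1 i]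
  have h1 := h.tOne_mul
  have h0 := h.tZero_mul
  have d1 : ((n : ℝ) - 1) * (1 / ((n : ℝ) - 1)) = 1 := by field_simp
  have d0 : (n : ℝ) * (2 / n) = 2 := by field_simp
  simp only [Nat.cast_one, Nat.cast_zero]
  linear_combination i (tOne L bh) * h1 + i (tZero L bl) * h0
    + lev L 1 * tOne L bh * i (tOne L bh) * d1 + lev L 0 * tZero L bl * i (tZero L bl) * d0

/-! ### Thresholds, feasibility and revenue of the explicit marginals -/

lemma minSecmax_eq_of_le_of_lt {f : Marginals} {k : ℕ} {t : ℝ} (ht : t ∈ Set.Icc (0 : ℝ) 1)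
    (hge : 2 ≤ (k : ℝ) * (f.one k).real (Set.Icc t 1)
      + ((n : ℝ) - k) * (f.zero k).real (Set.Icc t 1))
    (hlt : ∀ u, t < u → u ≤ 1 → (k : ℝ) * (f.one k).real (Set.Icc u 1)
      + ((n : ℝ) - k) * (f.zero k).real (Set.Icc u 1) < 2) : minSecmax n f k = t := by
  unfold minSecmax
  refine IsGreatest.csSup_eq ⟨⟨ht, by linarith⟩, fun u hu => ?_⟩
  by_contra hcon
  linarith [hlt u (not_le.1 hcon) hu.1.2, hu.2]

lemma minSecmax_optMarginals_zero (hn : 2 ≤ n) (h : LinSysWeak L bh bl) :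
    minSecmax n (optMarginals L bh bl) 0 = tZero L bl := by
  have hn' : (2 : ℝ) ≤ n := by exact_mod_cast hn
  have hn0 : (n : ℝ) ≠ 0 := by linarith
  have hm := h.tZero_mem
  refine minSecmax_eq_of_le_of_lt hm ?_ fun u hu hu1 => ?_
  · rw [measureReal_eq_integral_indicator _ measurableSet_Icc,
      measureReal_eq_integral_indicator _ measurableSet_Icc, integral_optMarginals_zero_zero hn]
    rw [Set.indicator_of_mem (s := Set.Icc (tZero L bl) 1) (a := tZero L bl) ⟨le_rfl, hm.2⟩]
    -- If `t_0* = 0` the atom at `0` also counts, so only the sign of its contribution is used.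
    have : 0 ≤ (Set.Icc (tZero L bl) 1).indicator (fun _ => (1 : ℝ)) 0 :=
      Set.indicator_nonneg (fun _ _ => zero_le_one) _
    have e : ((n : ℝ) - 2) / n * n = n - 2 := by field_simp
    have d0 : (n : ℝ) * (2 / n) = 2 := by field_simp
    simp only [Nat.cast_zero, zero_mul, sub_zero, zero_add]
    nlinarith [mul_nonneg (by linarith : 0 ≤ (n : ℝ) - 2) this]
  · rw [measureReal_eq_integral_indicator _ measurableSet_Icc,
      measureReal_eq_integral_indicator _ measurableSet_Icc, integral_optMarginals_zero_zero hn]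
    rw [Set.indicator_of_notMem (a := tZero L bl) (fun hc => absurd hc.1 (not_le.2 hu)),
      Set.indicator_of_notMem (a := (0 : ℝ))
        (fun hc => absurd hc.1 (not_le.2 (hm.1.trans_lt hu)))]
    simp

lemma minSecmax_optMarginals_one (hn : 2 ≤ n) (h : LinSysWeak L bh bl) :
    minSecmax n (optMarginals L bh bl) 1 = tOne L bh := by
  have hn' : (2 : ℝ) ≤ n := by exact_mod_cast hn
  have hn0 : (n : ℝ) - 1 ≠ 0 := by linarith
  have hm := h.tOne_mem
  refine minSecmax_eq_of_le_of_lt hm ?_ fun u hu hu1 => ?_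
  · rw [measureReal_eq_integral_indicator _ measurableSet_Icc,
      measureReal_eq_integral_indicator _ measurableSet_Icc, integral_optMarginals_zero_one hn,
      optMarginals_one_one, integral_dirac]
    rw [Set.indicator_of_mem (s := Set.Icc (tOne L bh) 1) (a := tOne L bh) ⟨le_rfl, hm.2⟩]
    have : 0 ≤ (Set.Icc (tOne L bh) 1).indicator (fun _ => (1 : ℝ)) 0 :=
      Set.indicator_nonneg (fun _ _ => zero_le_one) _
    have e : ((n : ℝ) - 2) / ((n : ℝ) - 1) * ((n : ℝ) - 1) = n - 2 := by field_simp
    have d0 : ((n : ℝ) - 1) * (1 / ((n : ℝ) - 1)) = 1 := by field_simp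
    simp only [Nat.cast_one]
    nlinarith [mul_nonneg (by linarith : 0 ≤ (n : ℝ) - 2) this]
  · rw [measureReal_eq_integral_indicator _ measurableSet_Icc,
      measureReal_eq_integral_indicator _ measurableSet_Icc, integral_optMarginals_zero_one hn,
      optMarginals_one_one, integral_dirac]
    rw [Set.indicator_of_notMem (a := tOne L bh) (fun hc => absurd hc.1 (not_le.2 hu)),
      Set.indicator_of_notMem (a := (0 : ℝ))
        (fun hc => absurd hc.1 (not_le.2 (hm.1.trans_lt hu)))]
    simp

lemma minSecmax_optMarginals_of_two_le (h : LinSysWeak L bh bl) {k : ℕ}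
    (hk : 2 ≤ k) (hkn : k ≤ n) : minSecmax n (optMarginals L bh bl) k = 1 := by
  refine minSecmax_eq_of_le_of_lt (by simp) ?_ fun u hu hu1 => absurd hu (not_lt.2 hu1)
  obtain ⟨b1, b2⟩ := h.nonneg k (Finset.mem_Icc.2 ⟨hk, hkn⟩)
  have hnk : (0 : ℝ) ≤ (n : ℝ) - k := sub_nonneg.2 (by exact_mod_cast hkn)
  have hk0 : (k : ℝ) ≠ 0 := by positivity
  have hz : 0 ≤ ((n : ℝ) - k) * ((optMarginals L bh bl).zero k).real (Set.Icc 1 1) :=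
    mul_nonneg hnk measureReal_nonneg
  rw [measureReal_eq_integral_indicator ((optMarginals L bh bl).one k) measurableSet_Icc,
    integral_optMarginals_one h hk hkn, Set.indicator_of_mem (a := (1 : ℝ)) (by simp)]
  have i1 : ∀ x, 0 ≤ (Set.Icc (1 : ℝ) 1).indicator (fun _ => (1 : ℝ)) x := fun x =>
    Set.indicator_nonneg (fun _ _ => zero_le_one) _
  have d : (k : ℝ) * (2 / k) = 2 := by field_simp
  have := mul_nonneg (Nat.cast_nonneg (α := ℝ) k)
    (add_nonneg (mul_nonneg b1 (i1 (tOne L bh))) (mul_nonneg b2 (i1 (tZero L bl))))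
  linarith

lemma optMarginals_mem_feasibleDagger (hn : 2 ≤ n) (h : LinSysWeak L bh bl) :
    optMarginals L bh bl ∈ feasibleDagger L := by
  have hn' : (2 : ℝ) ≤ n := by exact_mod_cast hn
  refine ⟨⟨fun k hk => isDist_optMarginals hn h hk, calibrated_optMarginals hn h⟩, ?_, ?_⟩
  · intro B hB hBs
    rw [minSecmax_optMarginals_one hn h] at hBs
    have : ((optMarginals L bh bl).one 1).real B = 0 := by
      rw [measureReal_eq_integral_indicator _ hB, optMarginals_one_one, integral_dirac]
      exact Set.indicator_of_notMem (fun hc => absurd (hBs hc).1 (lt_irrefl _)) _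
    rw [this]
    exact mul_nonneg (by linarith) measureReal_nonneg
  · intro B hB hBs
    have : ((optMarginals L bh bl).zero (n - 1)).real B = 0 := by
      rw [measureReal_eq_integral_indicator _ hB]
      -- For `n = 2` level `n - 1` is level one, whose atoms lie at or below `t_1*`; for larger `n`
      -- the threshold is `1` and the interval is empty.
      rcases hn.eq_or_lt with hn2 | hn3
      · subst hn2
        have hB0 := h.tOne_mem.1
        rw [show 2 - 1 = 1 from rfl, minSecmax_optMarginals_one le_rfl h] at hBs
        rw [show 2 - 1 = 1 from rfl, integral_optMarginals_zero_one le_rfl,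
          Set.indicator_of_notMem (a := tOne L bh) (fun hc => absurd (hBs hc).1 (lt_irrefl _)),
          Set.indicator_of_notMem (a := (0 : ℝ))
            (fun hc => absurd (hBs hc).1 (not_lt.2 hB0))]
        simp
      · have h2 : 2 ≤ n - 1 := by omega
        rw [minSecmax_optMarginals_of_two_le h h2 (by omega), Set.Ioc_self] at hBs
        simp [Set.subset_empty_iff.1 hBs]
    rw [this]
    exact mul_nonneg (by linarith) measureReal_nonneg

/-- Every atom of level `k` lies at or below `t_k`, so the excess over `t_k` integrates to zero. -/
lemma revenueAt_optMarginals (hn : 2 ≤ n) (h : LinSysWeak L bh bl) {k : ℕ} (hk : k ≤ n) :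
    revenueAt n (optMarginals L bh bl) k = minSecmax n (optMarginals L bh bl) k := by
  have hz : ∀ {t : ℝ}, 0 ≤ t → (Set.Icc t 1).indicator (fun x => x - t) 0 = 0 := by
    intro t ht
    refine Set.indicator_apply_eq_zero.2 fun hx => ?_
    linarith [hx.1]
  have hs : ∀ t : ℝ, (Set.Icc t 1).indicator (fun x => x - t) t = 0 := fun t =>
    Set.indicator_apply_eq_zero.2 fun _ => sub_self t
  unfold revenueAt
  rw [← integral_indicator measurableSet_Icc, ← integral_indicator measurableSet_Icc]
  obtain rfl | rfl | hk2 : k = 0 ∨ k = 1 ∨ 2 ≤ k := by omega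
  · rw [minSecmax_optMarginals_zero hn h, integral_optMarginals_zero_zero hn,
      hz h.tZero_mem.1, hs]
    simp
  · rw [minSecmax_optMarginals_one hn h, integral_optMarginals_zero_one hn, optMarginals_one_one,
      integral_dirac, hz h.tOne_mem.1, hs]
    simp
  · have h1 : ∀ x, (Set.Icc (1 : ℝ) 1).indicator (fun x => x - 1) x = 0 := fun x =>
      Set.indicator_apply_eq_zero.2 fun hx => by linarith [hx.1, hx.2]
    rw [minSecmax_optMarginals_of_two_le h hk2 hk]
    simp only [h1]
    simp

lemma revenue_optMarginals (hn : 2 ≤ n) (h : LinSysWeak L bh bl) :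
    revenue L (optMarginals L bh bl) = programValue L (xStar L, slack L - xStar L) := by
  have e : revenue L (optMarginals L bh bl)
      = ∑ k ∈ Finset.range (n + 1), lev L k * minSecmax n (optMarginals L bh bl) k :=
    Finset.sum_congr rfl fun k hk => congrArg (lev L k * ·)
      (revenueAt_optMarginals hn h (Nat.lt_succ_iff.1 (Finset.mem_range.1 hk)))
  have e2 : ∑ k ∈ Finset.Icc 2 n, lev L k * minSecmax n (optMarginals L bh bl) k
      = ∑ k ∈ Finset.Icc 2 n, lev L k := Finset.sum_congr rfl fun k hk => by
    rw [minSecmax_optMarginals_of_two_le h (Finset.mem_Icc.1 hk).1 (Finset.mem_Icc.1 hk).2,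
      mul_one]
  rw [e, sum_range_succ_eq_add_sum_Icc hn, e2, minSecmax_optMarginals_zero hn h,
    minSecmax_optMarginals_one hn h]
  unfold tZero tOne programValue
  rw [h.weight_high, h.weight_low]
  ring

lemma isMaxOn_revenue (hn : 2 ≤ n) (h : LinSysWeak L bh bl) :
    IsMaxOn (revenue L) (feasibleDagger L) (optMarginals L bh bl) := by
  obtain ⟨q, v, hf, hle⟩ := exists_dualValue_le L
  intro f hfeas
  change revenue L f ≤ revenue L (optMarginals L bh bl)
  rw [revenue_optMarginals hn h]
  exact (revenue_le_dualValue hn hfeas hf).trans hle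

lemma optMarginals_support (k : ℕ) :
    (optMarginals L bh bl).one k {0, tZero L bl, tOne L bh, 1}ᶜ = 0 ∧
    (optMarginals L bh bl).zero k {0, tZero L bl, tOne L bh, 1}ᶜ = 0 := by
  have hS : MeasurableSet ({0, tZero L bl, tOne L bh, 1} : Set ℝ)ᶜ :=
    (Set.toFinite _).measurableSet.compl
  obtain rfl | rfl | hk2 : k = 0 ∨ k = 1 ∨ 2 ≤ k := by omega
  · rw [optMarginals_one_zero, optMarginals_zero_zero]
    simp [Measure.dirac_apply' _ hS]
  · rw [optMarginals_one_one, optMarginals_zero_one]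
    simp [Measure.dirac_apply' _ hS]
  · rw [optMarginals_one_of_two_le hk2, optMarginals_zero_of_two_le hk2]
    simp [Measure.dirac_apply' _ hS]

end Explicit

end CalibratedAuction

end

theorem mainTheorem7 (n : ℕ) (hn : 2 ≤ n) (L : CalibratedAuction.OutcomePrior n) :
    -- the two-variable program is concave and `(x*, A - x*)` is an optimal solution of it
    ConcaveOn ℝ (CalibratedAuction.programDomain L) (CalibratedAuction.programValue L) ∧
    (CalibratedAuction.xStar L, CalibratedAuction.slack L - CalibratedAuction.xStar L)
      ∈ CalibratedAuction.programDomain L ∧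
    IsMaxOn (CalibratedAuction.programValue L) (CalibratedAuction.programDomain L)
      (CalibratedAuction.xStar L, CalibratedAuction.slack L - CalibratedAuction.xStar L) ∧
    -- solvability of the linear system
    (∃ bh bl : ℕ → ℝ, CalibratedAuction.LinSysWeak L bh bl) ∧
    (3 ≤ n → 0 < CalibratedAuction.lev L 0 →
      ∃ bh bl : ℕ → ℝ, CalibratedAuction.LinSys L bh bl) ∧
    -- every solution yields optimal marginals, with signals in `{0, t*_0, t*_1, 1}`
    (∀ bh bl : ℕ → ℝ, CalibratedAuction.LinSysWeak L bh bl →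
      CalibratedAuction.optMarginals L bh bl ∈ CalibratedAuction.feasibleDagger L ∧
      IsMaxOn (CalibratedAuction.revenue L) (CalibratedAuction.feasibleDagger L)
        (CalibratedAuction.optMarginals L bh bl) ∧
      CalibratedAuction.revenue L (CalibratedAuction.optMarginals L bh bl)
        = CalibratedAuction.programValue L
            (CalibratedAuction.xStar L,
              CalibratedAuction.slack L - CalibratedAuction.xStar L) ∧
      (∀ k ≤ n,
        (CalibratedAuction.optMarginals L bh bl).one k
          {0, CalibratedAuction.tZero L bl, CalibratedAuction.tOne L bh, 1}ᶜ = 0 ∧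
        (CalibratedAuction.optMarginals L bh bl).zero k
          {0, CalibratedAuction.tZero L bl, CalibratedAuction.tOne L bh, 1}ᶜ = 0)) := by
  exact ⟨CalibratedAuction.concaveOn_programValue L,
    CalibratedAuction.mem_programDomain_xStar L,
    CalibratedAuction.isMaxOn_programValue L,
    CalibratedAuction.exists_linSysWeak L,
    fun h3 h0 => CalibratedAuction.exists_linSys L h3 h0,
    fun bh bl h => ⟨CalibratedAuction.optMarginals_mem_feasibleDagger hn h,
      CalibratedAuction.isMaxOn_revenue hn h,
      CalibratedAuction.revenue_optMarginals hn h,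
      fun k _ => CalibratedAuction.optMarginals_support k⟩⟩
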